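/- Let $d\ge 2$ and let $A,B$ be qudits with computational basis $\{|l\rangle\}_{l\in\mathbb Z_d}$. For $\pi\in S_3$ put $W_\pi=\sum_{s}|s_{\pi(1)},s_{\pi(2)},s_{\pi(3)}\rangle\langle s_1,s_2,s_3|$, $M_\pm=W_{(123)}\pm W_{(132)}$ and $M_{neg}=W^A_{(123)}\otimes W^B_{(132)}+W^A_{(132)}\otimes W^B_{(123)}$. For a probability measure $\mu$ on $U(d)$ let $\Phi^3_\mu(X)=\mathbb E_{U\sim\mu}[U^{\otimes 3}X(U^\dagger)^{\otimes 3}]$; $\mu$ is a unitary $3$-design if $\Phi^3_\mu=\Phi^3_{\mathrm{Haar}}$ (in particular Haar measure is one). Let $U_A,U_B$ be independent, each drawn from a unitary $3$-design (the two designs may differ), and let $$(\Phi^3_A\otimes\Phi^3_B)(X)=\mathbb E\big[(U_A^{\otimes3}\otimes U_B^{\otimes3})\,X\,(U_A^{\otimes3}\otimes U_B^{\otimes3})^\dagger\big].$$ Let $|\Psi_{u,v}\rangle=d^{-1/2}\sum_l e^{2\pi i lv/d}|l\rangle_A|l+u\rangle_B$ and $\Psi_{u,v}=|\Psi_{u,v}\rangle\langle\Psi_{u,v}|$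 for $u,v\in\mathbb Z_d$. For $p=((u_1,v_1),(u_2,v_2),(u_3,v_3))\in(\mathbb Z_d^2)^3$ let $wt(p)\in\{1,2,3\}$ be the largest number of equal entries, and $$\theta(p)=(u_1v_2+u_2v_3+u_3v_1)-(u_1v_3+u_2v_1+u_3v_2)\in\mathbb Z_d .$$ Let $H=\{d/2\}$ if $d$ is even and $H=\{(d-1)/2,(d+1)/2\}\subset\mathbb Z_d$ if $d$ is odd. Let $n_3,n_2$ be the numbers of $p$ with $wt(p)=3,2$, and let $n_0,n_H$ be the numbers of $p$ with $wt(p)=1$ and $\theta(p)=0$, respectively $\theta(p)\in H$. Put $Q_3=d^2(d^2-1)^2$, $Q_2=-3Q_3$ and $$Q_0=-\tfrac12(d^2-4)\,Q_3,\quad Q_H=\tfrac12 d^2\,Q_3\qquad(d\text{ even}),$$ $$Q_0=-\frac{d^2-2-2\cos(\pi/d)}{1+\cos(\pi/d)}\,Q_3,\quad Q_H=\tfrac12 d^2\sec^2\!\big(\tfrac{\pi}{2d}\big)\,Q_3\qquad(d\text{ odd}).$$ Define $O_{--}=\sum_p O(p)\,\Psi_{u_1,v_1}\otimes\Psi_{u_2,v_2}\otimes\Psi_{u_3,v_3}$,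 where $O(p)=Q_3/n_3$ if $wt(p)=3$, $O(p)=Q_2/n_2$ if $wt(p)=2$, $O(p)=Q_0/n_0$ if $wt(p)=1,\theta(p)=0$, $O(p)=Q_H/n_H$ if $wt(p)=1,\theta(p)\in H$, and $O(p)=0$ otherwise. Define $O_+=\sum_{a\in\mathbb Z_d^3}[1+(-d)^{wt(a)-1}]\,|a\rangle\langle a|$, where $wt(a)$ is again the largest number of equal entries. Then: 1. $O_{--}$ is Hermitian and $(\Phi^3_A\otimes\Phi^3_B)(O_{--})=M_-^A\otimes M_-^B$. Operationally, for every state $\rho$ on $AB$, $$\mathbb E\Big[\sum_p O(p)\prod_{i=1}^3 P(u_i,v_i\,|\,U_A,U_B)\Big]=\mathrm{Tr}\big[(M_-^A\otimes M_-^B)\,\rho^{\otimes3}\big],$$ where $P(u,v\,|\,U_A,U_B)=\mathrm{Tr}\big[\Psi_{u,v}(U_A\otimes U_B)\rho(U_A\otimes U_B)^\dagger\big]$ is the outcome probability of the Bell-state measurement. 2. $(\Phi^3_A\otimes\Phi^3_B)(O_+\otimes O_+)=M_+^A\otimes M_+^B$, and $$M_{neg}=\tfrac12\big(M_+^A\otimes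 M_+^B-M_-^A\otimes M_-^B\big)=(\Phi^3_A\otimes\Phi^3_B)\Big(\tfrac12\big(O_+\otimes O_+-O_{--}\big)\Big).$$ -/

import Mathlib

open MeasureTheory
open scoped Kronecker ComplexOrder

noncomputable section

namespace BellNegativity

/-! ### The unitary group `U(d)`, Haar measure, twirling and unitary designs -/

/-- The group of unitary operators on a qudit with computational basis `ℤ/d`. -/
abbrev UGroup (d : ℕ) [NeZero d] : Type := Matrix.unitaryGroup (ZMod d) ℂ

instance instMeasurableSpaceUGroup (d : ℕ) [NeZero d] : MeasurableSpace (UGroup d) := borel _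

instance instBorelSpaceUGroup (d : ℕ) [NeZero d] : BorelSpace (UGroup d) := ⟨rfl⟩

instance instCompactSpaceUGroup (d : ℕ) [NeZero d] : CompactSpace (UGroup d) := by
  apply isCompact_iff_compactSpace.mp
  have h : IsCompact (Set.pi Set.univ fun _ : ZMod d =>
      Set.pi Set.univ fun _ : ZMod d => Metric.closedBall (0 : ℂ) 1) :=
    isCompact_univ_pi fun _ => isCompact_univ_pi fun _ => isCompact_closedBall 0 1
  refine IsCompact.of_isClosed_subset (X := Matrix (ZMod d) (ZMod d) ℂ) h
    (isClosed_unitary (R := Matrix (ZMod d) (ZMod d) ℂ)) ?_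
  intro U hU i _ j _
  simpa using entry_norm_bound_of_unitary (𝕜 := ℂ) hU i j

/-- The normalized Haar measure on `U(d)`. -/
def haarU (d : ℕ) [NeZero d] : Measure (UGroup d) := Measure.haarMeasure ⊤

instance instIsProbabilityMeasureHaarU (d : ℕ) [NeZero d] : IsProbabilityMeasure (haarU d) :=
  ⟨by simpa [haarU] using
    Measure.haarMeasure_self (K₀ := (⊤ : TopologicalSpace.PositiveCompacts (UGroup d)))⟩

/-- The `k`-fold tensor power `M^{⊗k}`, in the product basis. -/
def tensorPow {n : Type*} (k : ℕ) (M : Matrix n n ℂ) : Matrix (Fin k → n) (Fin k → n) ℂ :=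
  Matrix.of fun a b => ∏ i, M (a i) (b i)

/-- The `k`-fold twirl `Φ^k(X) = 𝔼_U [U^{⊗k} X (U†)^{⊗k}]` over the ensemble `μ`
(the matrix-valued integral is taken entrywise). -/
def twirl {d : ℕ} [NeZero d] (k : ℕ) (μ : Measure (UGroup d))
    (X : Matrix (Fin k → ZMod d) (Fin k → ZMod d) ℂ) :
    Matrix (Fin k → ZMod d) (Fin k → ZMod d) ℂ :=
  Matrix.of fun a b => ∫ U, (tensorPow k (U : Matrix (ZMod d) (ZMod d) ℂ) * X *
    (tensorPow k (U : Matrix (ZMod d) (ZMod d) ℂ)).conjTranspose) a b ∂μ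

/-- The ensemble `μ` is a unitary `k`-design: its `k`-fold twirl is that of the Haar measure. -/
def IsUnitaryDesign {d : ℕ} [NeZero d] (k : ℕ) (μ : Measure (UGroup d)) : Prop :=
  ∀ X, twirl k μ X = twirl k (haarU d) X

/-- The Haar measure is a unitary `k`-design for every `k`. -/
theorem isUnitaryDesign_haarU (d : ℕ) [NeZero d] (k : ℕ) : IsUnitaryDesign k (haarU d) :=
  fun _ => rfl

/-- Basis labels for three copies of the two-qudit system `AB`, grouped as `A^{⊗3} ⊗ B^{⊗3}`. -/
abbrev Idx (d : ℕ) : Type := (Fin 3 → ZMod d) × (Fin 3 → ZMod d)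

/-- The local twirl `Φ³_A ⊗ Φ³_B`, with independent random unitaries on `A` and on `B`. -/
def localTwirl {d : ℕ} [NeZero d] (μA μB : Measure (UGroup d)) (X : Matrix (Idx d) (Idx d) ℂ) :
    Matrix (Idx d) (Idx d) ℂ :=
  Matrix.of fun x y => ∫ g : UGroup d × UGroup d,
    ((tensorPow 3 (g.1 : Matrix (ZMod d) (ZMod d) ℂ) ⊗ₖ
        tensorPow 3 (g.2 : Matrix (ZMod d) (ZMod d) ℂ)) * X *
      (tensorPow 3 (g.1 : Matrix (ZMod d) (ZMod d) ℂ) ⊗ₖ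
        tensorPow 3 (g.2 : Matrix (ZMod d) (ZMod d) ℂ)).conjTranspose) x y ∂(μA.prod μB)

/-! ### Permutation operators -/

/-- `W_π = ∑_s |s_{π(1)}, s_{π(2)}, s_{π(3)}⟩⟨s_1, s_2, s_3|`. -/
def permOp (d : ℕ) [NeZero d] (π : Equiv.Perm (Fin 3)) :
    Matrix (Fin 3 → ZMod d) (Fin 3 → ZMod d) ℂ :=
  Matrix.of fun a s => if a = s ∘ π then 1 else 0

/-- `W_(123)`, i.e. `|a₁,a₂,a₃⟩ ↦ |a₂,a₃,a₁⟩`. -/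
def W0 (d : ℕ) [NeZero d] : Matrix (Fin 3 → ZMod d) (Fin 3 → ZMod d) ℂ := permOp d (finRotate 3)

/-- `W_(132)`. -/
def W1 (d : ℕ) [NeZero d] : Matrix (Fin 3 → ZMod d) (Fin 3 → ZMod d) ℂ := permOp d (finRotate 3)⁻¹

/-- `M_+ = W_(123) + W_(132)`. -/
def Mplus (d : ℕ) [NeZero d] : Matrix (Fin 3 → ZMod d) (Fin 3 → ZMod d) ℂ := W0 d + W1 d

/-- `M_- = W_(123) - W_(132)`. -/
def Mminus (d : ℕ) [NeZero d] : Matrix (Fin 3 → ZMod d) (Fin 3 → ZMod d) ℂ := W0 d - W1 d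

/-- The negativity operator `W_(123) ⊗ W_(132) + W_(132) ⊗ W_(123)`. -/
def Mneg (d : ℕ) [NeZero d] : Matrix (Idx d) (Idx d) ℂ := W0 d ⊗ₖ W1 d + W1 d ⊗ₖ W0 d

/-! ### Bell states and Bell-diagonal operators -/

/-- The qudit Bell state `|Ψ_{u,v}⟩ = d^{-1/2} ∑_l exp(2πi l v / d) |l⟩_A |l + u⟩_B`;
`ZMod.stdAddChar j` is `exp(2πi j / d)`. -/
def bellVec (d : ℕ) [NeZero d] (u v : ZMod d) : ZMod d × ZMod d → ℂ :=
  fun x => if x.2 = x.1 + u then ((Real.sqrt d : ℝ) : ℂ)⁻¹ * ZMod.stdAddChar (x.1 * v) else 0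

/-- The projector `Ψ_{u,v} = |Ψ_{u,v}⟩⟨Ψ_{u,v}|`. -/
def bellProj (d : ℕ) [NeZero d] (u v : ZMod d) : Matrix (ZMod d × ZMod d) (ZMod d × ZMod d) ℂ :=
  Matrix.vecMulVec (bellVec d u v) (star (bellVec d u v))

/-- The tensor product `M₁ ⊗ M₂ ⊗ M₃` of operators on the three copies of `AB`, written in the
basis grouped as `A^{⊗3} ⊗ B^{⊗3}`. -/
def copyTensor {d : ℕ} (M : Fin 3 → Matrix (ZMod d × ZMod d) (ZMod d × ZMod d) ℂ) :
    Matrix (Idx d) (Idx d) ℂ :=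
  Matrix.of fun x y => ∏ i, M i (x.1 i, x.2 i) (y.1 i, y.2 i)

/-- The Bell-diagonal observable `∑ O((u₁,v₁),(u₂,v₂),(u₃,v₃)) Ψ_{u₁,v₁} ⊗ Ψ_{u₂,v₂} ⊗ Ψ_{u₃,v₃}`
with real coefficients. -/
def bellDiagonal {d : ℕ} [NeZero d] (O : (Fin 3 → ZMod d × ZMod d) → ℝ) :
    Matrix (Idx d) (Idx d) ℂ :=
  ∑ p, (O p : ℂ) • copyTensor fun i => bellProj d (p i).1 (p i).2

/-! ### The coefficients -/

/-- The weight of a triple: the largest number of equal entries (`3`, `2` or `1`). -/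
def wt {α : Type*} [DecidableEq α] (p : Fin 3 → α) : ℕ :=
  Finset.univ.sup fun i => (Finset.univ.filter fun j => p j = p i).card

/-- The rotation angle `θ(u,v) = (1,1,1) · (u × v) ∈ ℤ/d` of `p = ((u₁,v₁),(u₂,v₂),(u₃,v₃))`. -/
def theta {d : ℕ} (p : Fin 3 → ZMod d × ZMod d) : ZMod d :=
  ((p 0).1 * (p 1).2 + (p 1).1 * (p 2).2 + (p 2).1 * (p 0).2) -
    ((p 0).1 * (p 2).2 + (p 1).1 * (p 0).2 + (p 2).1 * (p 1).2)

/-- The angles nearest to `d/2`: `d/2` for even `d`, and `(d-1)/2`, `(d+1)/2` for odd `d`. -/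
def halfAngles (d : ℕ) : Finset (ZMod d) :=
  if Even d then {((d / 2 : ℕ) : ZMod d)}
  else {(((d - 1) / 2 : ℕ) : ZMod d), (((d + 1) / 2 : ℕ) : ZMod d)}

/-- The number of triples of weight `w`. -/
def nWt (d : ℕ) [NeZero d] (w : ℕ) : ℕ :=
  (Finset.univ.filter fun p : Fin 3 → ZMod d × ZMod d => wt p = w).card

/-- The number of triples of weight `1` whose angle lies in `S`. -/
def nAngle (d : ℕ) [NeZero d] (S : Finset (ZMod d)) : ℕ :=
  (Finset.univ.filter fun p : Fin 3 → ZMod d × ZMod d => wt p = 1 ∧ theta p ∈ S).card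

/-- The common prefactor `d² (d² - 1)²`, which is also the total coefficient in weight `3`. -/
def Q3 (d : ℕ) : ℝ := (d : ℝ) ^ 2 * ((d : ℝ) ^ 2 - 1) ^ 2

/-- The total coefficient in weight `2`. -/
def Q2 (d : ℕ) : ℝ := -3 * Q3 d

/-- The total coefficient in weight `1` and angle `0`. -/
def Q1zero (d : ℕ) : ℝ :=
  if Even d then Q3 d * (-(((d : ℝ) ^ 2 - 4) / 2))
  else Q3 d * (-(((d : ℝ) ^ 2 - 2 - 2 * Real.cos (Real.pi / d)) / (1 + Real.cos (Real.pi / d))))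

/-- The total coefficient in weight `1` and the angles nearest to `d/2`. -/
def Q1half (d : ℕ) : ℝ :=
  if Even d then Q3 d * ((d : ℝ) ^ 2 / 2)
  else Q3 d * ((d : ℝ) ^ 2 / (2 * Real.cos (Real.pi / (2 * d)) ^ 2))

/-- The coefficients of `O_{--}`: each total is spread evenly over its class of triples. -/
def coeffMM (d : ℕ) [NeZero d] (p : Fin 3 → ZMod d × ZMod d) : ℝ :=
  if wt p = 3 then Q3 d / nWt d 3
  else if wt p = 2 then Q2 d / nWt d 2
  else if theta p = 0 then Q1zero d / nAngle d {0}
  else if theta p ∈ halfAngles d then Q1half d / nAngle d (halfAngles d)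
  else 0

/-- The Bell-diagonal observable `O_{--}`. -/
def OMM (d : ℕ) [NeZero d] : Matrix (Idx d) (Idx d) ℂ := bellDiagonal (coeffMM d)

/-- The computational-basis observable `O_+ = ∑_a [1 + (-d)^{wt(a) - 1}] |a⟩⟨a|`. -/
def Oplus (d : ℕ) [NeZero d] : Matrix (Fin 3 → ZMod d) (Fin 3 → ZMod d) ℂ :=
  Matrix.diagonal fun a => 1 + (-(d : ℂ)) ^ (wt a - 1)

/-! ### The Bell-state measurement after local unitaries -/

/-- The probability of the outcome `(u,v)` when the Bell-state measurement is performed on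
`(U ⊗ V) ρ (U ⊗ V)†`. -/
def bellProb {d : ℕ} [NeZero d] (ρ : Matrix (ZMod d × ZMod d) (ZMod d × ZMod d) ℂ)
    (U V : UGroup d) (q : ZMod d × ZMod d) : ℂ :=
  (bellProj d q.1 q.2 *
    (((U : Matrix (ZMod d) (ZMod d) ℂ) ⊗ₖ (V : Matrix (ZMod d) (ZMod d) ℂ)) * ρ *
      ((U : Matrix (ZMod d) (ZMod d) ℂ) ⊗ₖ (V : Matrix (ZMod d) (ZMod d) ℂ)).conjTranspose)).trace

end BellNegativity

end

/-! Twirling over a 3-design projects onto the commutant of all `U^{⊗3}`, which Schur–Weyl duality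
identifies with the span of the six operators `W_σ` (`mem_permSpan_of_commute`). The local twirl
therefore lands in the span of the products `W_σ ⊗ W_τ`. It also preserves every trace against such
a product. The span is closed under adjoints, so the Hilbert–Schmidt form is definite on it and
these 36 traces determine an element, even though the `W_σ` are linearly dependent for `d = 2`. Each
twirling identity thus becomes a comparison of traces (`localTwirl_eq_of_trace`).

For `O_{--}`, the overlap of `W_σ ⊗ W_τ` with a product of Bell projectors is a finite character sum
`bellSum`. Its dependence on `p` takes four forms: constant, the indicator of two equal labels, the
indicator of three equal labels (equal 3-cycles), or the phase of `∓θ(p)` (opposite 3-cycles). Since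
the coefficients are symmetric under permuting copies, only pairs `(σ, τ)` up to simultaneous
conjugation matter, and four linear conditions on the class totals remain: `Q₃ + Q₂ + Q₀ + Q_H = 0`,
`3Q₃ + Q₂ = 0`, `Q₃ = (d³ - d)²`, `Q₃ + Q₂ + Q₀ - cQ_H = -d²Q₃`, where `-c` is the cosine at the
angles nearest `d/2`, so `c = 1` for even `d` and `c = cos(π/d)` for odd `d`. The prescribed totals
are the solution. For `O_+` the traces factor and the check is a count of coinciding indices.

The operational statement writes the product of outcome probabilities as one trace and moves the
twirl from `ρ^{⊗3}` to `O_{--}`. -/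

namespace BellNegativity

open scoped Matrix

/-! ### Twirls: integrability, linearity, invariance -/

section Twirl

variable {d : ℕ} [NeZero d]

/-- Linear functionals commute with entrywise integration of matrices. -/
theorem integral_linearMap_matrix {Ω m n : Type*} [MeasurableSpace Ω] [Fintype m] [Fintype n]
    [DecidableEq m] [DecidableEq n] {μ : Measure Ω} (f : Ω → Matrix m n ℂ)
    (hf : ∀ a b, Integrable (fun ω => f ω a b) μ) (φ : Matrix m n ℂ →ₗ[ℂ] ℂ) :
    ∫ ω, φ (f ω) ∂μ = φ (Matrix.of fun a b => ∫ ω, f ω a b ∂μ) := by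
  have key : ∀ M : Matrix m n ℂ, φ M = ∑ a, ∑ b, M a b * φ (Matrix.single a b 1) := by
    intro M
    conv_lhs => rw [Matrix.matrix_eq_sum_single M]
    simp only [map_sum]
    refine Finset.sum_congr rfl fun a _ => Finset.sum_congr rfl fun b _ => ?_
    rw [← smul_eq_mul, ← map_smul, Matrix.smul_single, smul_eq_mul, mul_one]
  rw [key]
  simp_rw [key (f _)]
  rw [integral_finsetSum _ fun a _ => integrable_finsetSum _ fun b _ => (hf a b).mul_const _]
  refine Finset.sum_congr rfl fun a _ => ?_
  rw [integral_finsetSum _ fun b _ => (hf a b).mul_const _]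
  refine Finset.sum_congr rfl fun b _ => ?_
  rw [integral_mul_const, Matrix.of_apply]

theorem tensorPow_mul {n : Type*} [Fintype n] [DecidableEq n] (k : ℕ) (M N : Matrix n n ℂ) :
    tensorPow k (M * N) = tensorPow k M * tensorPow k N := by
  ext a b
  simp only [tensorPow, Matrix.of_apply, Matrix.mul_apply]
  rw [Fintype.prod_sum]
  exact Finset.sum_congr rfl fun c _ => Finset.prod_mul_distrib

theorem tensorPow_one {n : Type*} [Fintype n] [DecidableEq n] (k : ℕ) :
    tensorPow k (1 : Matrix n n ℂ) = 1 := by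
  ext a b
  simp only [tensorPow, Matrix.of_apply, Matrix.one_apply, Finset.prod_ite_zero, funext_iff]
  simp

theorem tensorPow_smul {n : Type*} (k : ℕ) (c : ℂ) (M : Matrix n n ℂ) :
    tensorPow k (c • M) = c ^ k • tensorPow k M := by
  ext a b
  simp [tensorPow, Finset.prod_mul_distrib]

theorem conjTranspose_tensorPow {n : Type*} (k : ℕ) (M : Matrix n n ℂ) :
    (tensorPow k M).conjTranspose = tensorPow k M.conjTranspose := by
  ext a b
  simp [tensorPow, Matrix.conjTranspose_apply]

theorem conjTranspose_tensorPow_mul_self (k : ℕ) (U : UGroup d) :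
    (tensorPow k (U : Matrix (ZMod d) (ZMod d) ℂ)).conjTranspose * tensorPow k (U : Matrix _ _ ℂ)
      = 1 := by
  rw [conjTranspose_tensorPow, ← tensorPow_mul, ← Matrix.star_eq_conjTranspose,
    Matrix.UnitaryGroup.star_mul_self, tensorPow_one]

theorem continuous_tensorPow_apply (k : ℕ) (a b : Fin k → ZMod d) :
    Continuous fun U : UGroup d => tensorPow k (U : Matrix (ZMod d) (ZMod d) ℂ) a b := by
  simp only [tensorPow, Matrix.of_apply]
  exact continuous_finsetProd _ fun i _ =>
    (continuous_subtype_val (p := fun M => M ∈ Matrix.unitaryGroup (ZMod d) ℂ)).matrix_elem _ _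

theorem integrable_twirl (k : ℕ) (μ : Measure (UGroup d)) [IsProbabilityMeasure μ]
    (X : Matrix (Fin k → ZMod d) (Fin k → ZMod d) ℂ) (a b : Fin k → ZMod d) :
    Integrable (fun U : UGroup d => (tensorPow k (U : Matrix (ZMod d) (ZMod d) ℂ) * X *
      (tensorPow k (U : Matrix (ZMod d) (ZMod d) ℂ)).conjTranspose) a b) μ := by
  have hc : Continuous fun U : UGroup d => (tensorPow k (U : Matrix (ZMod d) (ZMod d) ℂ) * X *
      (tensorPow k (U : Matrix (ZMod d) (ZMod d) ℂ)).conjTranspose) a b := by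
    simp only [Matrix.mul_apply, Matrix.conjTranspose_apply]
    refine continuous_finsetSum _ fun i _ => Continuous.mul (continuous_finsetSum _ fun j _ =>
      (continuous_tensorPow_apply k _ _).mul continuous_const)
      (continuous_star.comp (continuous_tensorPow_apply k _ _))
  exact hc.integrable_of_hasCompactSupport (HasCompactSupport.of_compactSpace _)

theorem linearMap_twirl (k : ℕ) (μ : Measure (UGroup d)) [IsProbabilityMeasure μ]
    (X : Matrix (Fin k → ZMod d) (Fin k → ZMod d) ℂ)
    (φ : Matrix (Fin k → ZMod d) (Fin k → ZMod d) ℂ →ₗ[ℂ] ℂ) :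
    φ (twirl k μ X) = ∫ U, φ (tensorPow k (U : Matrix (ZMod d) (ZMod d) ℂ) * X *
      (tensorPow k (U : Matrix (ZMod d) (ZMod d) ℂ)).conjTranspose) ∂μ :=
  (integral_linearMap_matrix _ (integrable_twirl k μ X) φ).symm

/-- The Haar twirl commutes with all tensor powers of unitaries. -/
theorem commute_tensorPow_twirl_haarU (k : ℕ) (X : Matrix (Fin k → ZMod d) (Fin k → ZMod d) ℂ)
    (V : UGroup d) :
    Commute (tensorPow k (V : Matrix (ZMod d) (ZMod d) ℂ)) (twirl k (haarU d) X) := by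
  have h : tensorPow k (V : Matrix (ZMod d) (ZMod d) ℂ) * twirl k (haarU d) X *
      (tensorPow k (V : Matrix (ZMod d) (ZMod d) ℂ)).conjTranspose = twirl k (haarU d) X := by
    ext a b
    have h1 := linearMap_twirl k (haarU d) X
      ((Matrix.entryLinearMap ℂ ℂ a b) ∘ₗ (LinearMap.mulRight ℂ
        (tensorPow k (V : Matrix (ZMod d) (ZMod d) ℂ)).conjTranspose) ∘ₗ
        (LinearMap.mulLeft ℂ (tensorPow k (V : Matrix (ZMod d) (ZMod d) ℂ))))
    simp only [LinearMap.comp_apply, Matrix.entryLinearMap_apply, LinearMap.mulLeft_apply,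
      LinearMap.mulRight_apply] at h1
    rw [h1]
    have h2 : ∀ U : UGroup d, (tensorPow k (V : Matrix (ZMod d) (ZMod d) ℂ) *
        (tensorPow k (U : Matrix (ZMod d) (ZMod d) ℂ) * X *
          (tensorPow k (U : Matrix (ZMod d) (ZMod d) ℂ)).conjTranspose) *
        (tensorPow k (V : Matrix (ZMod d) (ZMod d) ℂ)).conjTranspose) a b =
        (tensorPow k ((V * U : UGroup d) : Matrix (ZMod d) (ZMod d) ℂ) * X *
          (tensorPow k ((V * U : UGroup d) : Matrix (ZMod d) (ZMod d) ℂ)).conjTranspose) a b := by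
      intro U
      rw [Matrix.UnitaryGroup.mul_val, tensorPow_mul, Matrix.conjTranspose_mul]
      simp only [Matrix.mul_assoc]
    simp_rw [h2]
    have : (haarU d).IsMulLeftInvariant := by unfold haarU; infer_instance
    exact integral_mul_left_eq_self (μ := haarU d) (fun U : UGroup d =>
      (tensorPow k (U : Matrix (ZMod d) (ZMod d) ℂ) * X *
        (tensorPow k (U : Matrix (ZMod d) (ZMod d) ℂ)).conjTranspose) a b) V
  unfold Commute SemiconjBy
  conv_rhs => rw [← h]
  rw [Matrix.mul_assoc, conjTranspose_tensorPow_mul_self, Matrix.mul_one]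

/-- Twirling does not change the trace against an operator commuting with the ensemble. -/
theorem trace_mul_twirl (k : ℕ) (μ : Measure (UGroup d)) [IsProbabilityMeasure μ]
    (W X : Matrix (Fin k → ZMod d) (Fin k → ZMod d) ℂ)
    (hW : ∀ U : UGroup d, Commute (tensorPow k (U : Matrix (ZMod d) (ZMod d) ℂ)) W) :
    (W * twirl k μ X).trace = (W * X).trace := by
  have h1 := linearMap_twirl k μ X (Matrix.traceLinearMap _ ℂ ℂ ∘ₗ LinearMap.mulLeft ℂ W)
  simp only [LinearMap.comp_apply, Matrix.traceLinearMap_apply, LinearMap.mulLeft_apply] at h1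
  rw [h1]
  have h2 : ∀ U : UGroup d, (W * (tensorPow k (U : Matrix (ZMod d) (ZMod d) ℂ) * X *
      (tensorPow k (U : Matrix (ZMod d) (ZMod d) ℂ)).conjTranspose)).trace = (W * X).trace := by
    intro U
    rw [← Matrix.mul_assoc, Matrix.trace_mul_comm, ← Matrix.mul_assoc,
      Matrix.mul_assoc _ W, ← Matrix.mul_assoc W, ← (hW U).eq, Matrix.mul_assoc _ W X,
      ← Matrix.mul_assoc, conjTranspose_tensorPow_mul_self, Matrix.one_mul]
  simp_rw [h2]
  simp

theorem localTwirl_kronecker_integrand (X Y : Matrix (Fin 3 → ZMod d) (Fin 3 → ZMod d) ℂ)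
    (g : UGroup d × UGroup d) (x y : Idx d) :
    ((tensorPow 3 (g.1 : Matrix (ZMod d) (ZMod d) ℂ) ⊗ₖ
        tensorPow 3 (g.2 : Matrix (ZMod d) (ZMod d) ℂ)) * (X ⊗ₖ Y) *
      (tensorPow 3 (g.1 : Matrix (ZMod d) (ZMod d) ℂ) ⊗ₖ
        tensorPow 3 (g.2 : Matrix (ZMod d) (ZMod d) ℂ)).conjTranspose) x y =
    (tensorPow 3 (g.1 : Matrix (ZMod d) (ZMod d) ℂ) * X *
      (tensorPow 3 (g.1 : Matrix (ZMod d) (ZMod d) ℂ)).conjTranspose) x.1 y.1 *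
    (tensorPow 3 (g.2 : Matrix (ZMod d) (ZMod d) ℂ) * Y *
      (tensorPow 3 (g.2 : Matrix (ZMod d) (ZMod d) ℂ)).conjTranspose) x.2 y.2 := by
  rw [Matrix.conjTranspose_kronecker, ← Matrix.mul_kronecker_mul, ← Matrix.mul_kronecker_mul]
  rfl

/-- Independence of the two unitaries: on a product operator the integrand factors entrywise and
Fubini applies. -/
theorem localTwirl_kronecker (μA μB : Measure (UGroup d)) [IsProbabilityMeasure μA]
    [IsProbabilityMeasure μB] (X Y : Matrix (Fin 3 → ZMod d) (Fin 3 → ZMod d) ℂ) :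
    localTwirl μA μB (X ⊗ₖ Y) = twirl 3 μA X ⊗ₖ twirl 3 μB Y := by
  ext x y
  simp only [localTwirl, Matrix.of_apply, localTwirl_kronecker_integrand]
  exact integral_prod_mul
    (fun U : UGroup d => (tensorPow 3 (U : Matrix (ZMod d) (ZMod d) ℂ) * X *
      (tensorPow 3 (U : Matrix (ZMod d) (ZMod d) ℂ)).conjTranspose) x.1 y.1)
    (fun U : UGroup d => (tensorPow 3 (U : Matrix (ZMod d) (ZMod d) ℂ) * Y *
      (tensorPow 3 (U : Matrix (ZMod d) (ZMod d) ℂ)).conjTranspose) x.2 y.2)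

theorem eq_sum_smul_kronecker (X : Matrix (Idx d) (Idx d) ℂ) :
    X = ∑ s, ∑ t, X s t • (Matrix.single s.1 t.1 1 ⊗ₖ Matrix.single s.2 t.2 1) := by
  conv_lhs => rw [Matrix.matrix_eq_sum_single X]
  refine Finset.sum_congr rfl fun s _ => Finset.sum_congr rfl fun t _ => ?_
  rw [Matrix.single_kronecker_single, Matrix.smul_single]
  simp

theorem integrable_localTwirl (μA μB : Measure (UGroup d)) [IsProbabilityMeasure μA]
    [IsProbabilityMeasure μB] (X : Matrix (Idx d) (Idx d) ℂ) (x y : Idx d) :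
    Integrable (fun g : UGroup d × UGroup d =>
      ((tensorPow 3 (g.1 : Matrix (ZMod d) (ZMod d) ℂ) ⊗ₖ
        tensorPow 3 (g.2 : Matrix (ZMod d) (ZMod d) ℂ)) * X *
      (tensorPow 3 (g.1 : Matrix (ZMod d) (ZMod d) ℂ) ⊗ₖ
        tensorPow 3 (g.2 : Matrix (ZMod d) (ZMod d) ℂ)).conjTranspose) x y) (μA.prod μB) := by
  rw [eq_sum_smul_kronecker X]
  simp only [Finset.mul_sum, Finset.sum_mul, Matrix.sum_apply, Matrix.mul_smul, Matrix.smul_mul,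
    Matrix.smul_apply, localTwirl_kronecker_integrand, smul_eq_mul]
  exact integrable_finsetSum _ fun s _ => integrable_finsetSum _ fun t _ =>
    ((integrable_twirl 3 μA _ _ _).mul_prod (integrable_twirl 3 μB _ _ _)).const_mul _

theorem linearMap_localTwirl (μA μB : Measure (UGroup d)) [IsProbabilityMeasure μA]
    [IsProbabilityMeasure μB] (X : Matrix (Idx d) (Idx d) ℂ)
    (φ : Matrix (Idx d) (Idx d) ℂ →ₗ[ℂ] ℂ) :
    φ (localTwirl μA μB X) = ∫ g : UGroup d × UGroup d,
      φ ((tensorPow 3 (g.1 : Matrix (ZMod d) (ZMod d) ℂ) ⊗ₖ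
        tensorPow 3 (g.2 : Matrix (ZMod d) (ZMod d) ℂ)) * X *
      (tensorPow 3 (g.1 : Matrix (ZMod d) (ZMod d) ℂ) ⊗ₖ
        tensorPow 3 (g.2 : Matrix (ZMod d) (ZMod d) ℂ)).conjTranspose) ∂(μA.prod μB) :=
  (integral_linearMap_matrix _ (integrable_localTwirl μA μB X) φ).symm

theorem localTwirl_add (μA μB : Measure (UGroup d)) [IsProbabilityMeasure μA]
    [IsProbabilityMeasure μB] (X Y : Matrix (Idx d) (Idx d) ℂ) :
    localTwirl μA μB (X + Y) = localTwirl μA μB X + localTwirl μA μB Y := by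
  ext x y
  simp only [localTwirl, Matrix.of_apply, Matrix.mul_add, Matrix.add_mul, Matrix.add_apply]
  exact integral_add (integrable_localTwirl μA μB X x y) (integrable_localTwirl μA μB Y x y)

theorem localTwirl_smul (μA μB : Measure (UGroup d)) [IsProbabilityMeasure μA]
    [IsProbabilityMeasure μB] (c : ℂ) (X : Matrix (Idx d) (Idx d) ℂ) :
    localTwirl μA μB (c • X) = c • localTwirl μA μB X := by
  ext x y
  simp only [localTwirl, Matrix.of_apply, Matrix.mul_smul, Matrix.smul_mul, Matrix.smul_apply]
  exact integral_smul c _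

/-- The local twirl as a linear map. -/
noncomputable def localTwirlLinear (μA μB : Measure (UGroup d)) [IsProbabilityMeasure μA]
    [IsProbabilityMeasure μB] : Matrix (Idx d) (Idx d) ℂ →ₗ[ℂ] Matrix (Idx d) (Idx d) ℂ where
  toFun := localTwirl μA μB
  map_add' := localTwirl_add μA μB
  map_smul' := localTwirl_smul μA μB

theorem localTwirl_eq_sum (μA μB : Measure (UGroup d)) [IsProbabilityMeasure μA]
    [IsProbabilityMeasure μB] (X : Matrix (Idx d) (Idx d) ℂ) :
    localTwirl μA μB X = ∑ s, ∑ t, X s t •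
      (twirl 3 μA (Matrix.single s.1 t.1 1) ⊗ₖ twirl 3 μB (Matrix.single s.2 t.2 1)) := by
  have h : localTwirl μA μB X = localTwirlLinear μA μB X := rfl
  rw [h]
  conv_lhs => rw [eq_sum_smul_kronecker X]
  simp only [map_sum, map_smul]
  refine Finset.sum_congr rfl fun s _ => Finset.sum_congr rfl fun t _ => ?_
  congr 1
  exact localTwirl_kronecker μA μB _ _

end Twirl

/-! ### From the group `U(d)` to the action of its complexified Lie algebra -/

section Commutant

/-- The derivation `M ⊗ 1 ⊗ 1 + 1 ⊗ M ⊗ 1 + 1 ⊗ 1 ⊗ M`. -/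
def tensorDer {n : Type*} [DecidableEq n] (M : Matrix n n ℂ) :
    Matrix (Fin 3 → n) (Fin 3 → n) ℂ :=
  Matrix.of fun a b =>
    M (a 0) (b 0) * (1 : Matrix n n ℂ) (a 1) (b 1) * (1 : Matrix n n ℂ) (a 2) (b 2) +
    (1 : Matrix n n ℂ) (a 0) (b 0) * M (a 1) (b 1) * (1 : Matrix n n ℂ) (a 2) (b 2) +
    (1 : Matrix n n ℂ) (a 0) (b 0) * (1 : Matrix n n ℂ) (a 1) (b 1) * M (a 2) (b 2)

theorem tensorDer_add {n : Type*} [DecidableEq n] (M N : Matrix n n ℂ) :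
    tensorDer (M + N) = tensorDer M + tensorDer N := by
  ext a b
  simp only [tensorDer, Matrix.of_apply, Matrix.add_apply]
  ring

theorem tensorDer_smul {n : Type*} [DecidableEq n] (c : ℂ) (M : Matrix n n ℂ) :
    tensorDer (c • M) = c • tensorDer M := by
  ext a b
  simp only [tensorDer, Matrix.of_apply, Matrix.smul_apply, smul_eq_mul]
  ring

theorem one_apply_fin_three {n : Type*} [DecidableEq n] (a b : Fin 3 → n) :
    (1 : Matrix (Fin 3 → n) (Fin 3 → n) ℂ) a b = (1 : Matrix n n ℂ) (a 0) (b 0) *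
      (1 : Matrix n n ℂ) (a 1) (b 1) * (1 : Matrix n n ℂ) (a 2) (b 2) := by
  simp only [Matrix.one_apply, funext_iff, Fin.forall_fin_succ, Fin.succ_zero_eq_one,
    Fin.succ_one_eq_two, IsEmpty.forall_iff, and_true]
  split_ifs <;> simp_all

theorem tensorDer_one {n : Type*} [DecidableEq n] :
    tensorDer (1 : Matrix n n ℂ) = (3 : ℂ) • (1 : Matrix (Fin 3 → n) (Fin 3 → n) ℂ) := by
  ext a b
  rw [Matrix.smul_apply, one_apply_fin_three, smul_eq_mul]
  simp only [tensorDer, Matrix.of_apply]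
  ring

/-- Taking the odd part in `z` leaves only the linear and cubic terms. This extracts the derivation
algebraically, with no differentiation of a one-parameter group. -/
theorem tensorPow_one_add_sub_tensorPow_one_sub {n : Type*} [DecidableEq n] (z : ℂ)
    (H : Matrix n n ℂ) :
    tensorPow 3 (1 + z • H) - tensorPow 3 (1 + (-z) • H) =
      (2 * z) • tensorDer H + (2 * z ^ 3) • tensorPow 3 H := by
  ext a b
  simp only [tensorPow, tensorDer, Fin.prod_univ_three, Matrix.of_apply, Matrix.add_apply,
    Matrix.sub_apply, Matrix.smul_apply, smul_eq_mul]
  ring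

variable {d : ℕ} [NeZero d]

/-- `tensorPow 3` is homogeneous of degree three, so a nonzero multiple of a unitary is as good as a
unitary. -/
theorem commute_tensorPow_of_smul_mem (C : Matrix (Fin 3 → ZMod d) (Fin 3 → ZMod d) ℂ)
    (hC : ∀ U : UGroup d, Commute (tensorPow 3 (U : Matrix (ZMod d) (ZMod d) ℂ)) C)
    {M : Matrix (ZMod d) (ZMod d) ℂ} {r : ℂ} (hr : r ≠ 0)
    (hM : M * M.conjTranspose = (r * star r) • 1) : Commute (tensorPow 3 M) C := by
  have hmem : r⁻¹ • M ∈ Matrix.unitaryGroup (ZMod d) ℂ := by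
    rw [Matrix.mem_unitaryGroup_iff, Matrix.star_eq_conjTranspose, Matrix.conjTranspose_smul,
      Matrix.smul_mul, Matrix.mul_smul, hM, smul_smul, smul_smul]
    have hr' : star r ≠ 0 := star_ne_zero.mpr hr
    rw [star_inv₀]
    convert one_smul ℂ _
    field_simp
  have h1 := hC ⟨_, hmem⟩
  simp only [tensorPow_smul] at h1
  have h2 := h1.smul_left (r ^ 3)
  rwa [smul_smul, ← mul_pow, mul_inv_cancel₀ hr, one_pow, one_smul] at h2

/-- For a Hermitian involution `H`, both `1 ± iH` are `√2` times a unitary, and `H` is itself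
unitary. The odd part of `(1 + zH)^{⊗3}` at `z = i`, minus its cubic term, is a nonzero multiple of
`tensorDer H`. -/
theorem commute_tensorDer_of_involution (C : Matrix (Fin 3 → ZMod d) (Fin 3 → ZMod d) ℂ)
    (hC : ∀ U : UGroup d, Commute (tensorPow 3 (U : Matrix (ZMod d) (ZMod d) ℂ)) C)
    {H : Matrix (ZMod d) (ZMod d) ℂ} (hH : H.conjTranspose = H) (hH2 : H * H = 1) :
    Commute (tensorDer H) C := by
  have hz : ∀ z : ℂ, z * z = -1 → star z = -z → Commute (tensorPow 3 (1 + z • H)) C := by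
    intro z hz hz'
    have h2 : ((Real.sqrt 2 : ℝ) : ℂ) * ((Real.sqrt 2 : ℝ) : ℂ) = 2 := by
      rw [← Complex.ofReal_mul, Real.mul_self_sqrt (by norm_num)]; norm_num
    refine commute_tensorPow_of_smul_mem C hC (r := ((Real.sqrt 2 : ℝ) : ℂ)) ?_ ?_
    · intro h; rw [h] at h2; norm_num at h2
    · rw [show star ((Real.sqrt 2 : ℝ) : ℂ) = ((Real.sqrt 2 : ℝ) : ℂ) from Complex.conj_ofReal _,
        h2, Matrix.conjTranspose_add, Matrix.conjTranspose_one, Matrix.conjTranspose_smul, hH, hz']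
      rw [Matrix.add_mul, Matrix.mul_add, Matrix.one_mul, Matrix.one_mul, Matrix.mul_add,
        Matrix.mul_one, Matrix.smul_mul, Matrix.mul_smul, hH2, smul_smul, mul_neg, hz, two_smul]
      simp only [neg_neg, one_smul, neg_smul]
      abel
  have h0 : Commute (tensorPow 3 H) C := by
    refine commute_tensorPow_of_smul_mem C hC one_ne_zero ?_
    rw [hH, hH2]; simp
  have h1 := hz Complex.I (by simp) (by simp)
  have h2 := hz (-Complex.I) (by simp) (by simp)
  have h3 := (h1.sub_left h2).sub_left (h0.smul_left (2 * Complex.I ^ 3))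
  rw [tensorPow_one_add_sub_tensorPow_one_sub, add_sub_cancel_right] at h3
  have h4 := h3.smul_left (2 * Complex.I)⁻¹
  rwa [smul_smul, inv_mul_cancel₀ (by simp), one_smul] at h4

/-- With `P = v v†` and `P² = rP`, the reflection `1 - (2/r)P` is a Hermitian involution. The
identity part contributes only a scalar to `tensorDer`. -/
theorem commute_tensorDer_vecMulVec (C : Matrix (Fin 3 → ZMod d) (Fin 3 → ZMod d) ℂ)
    (hC : ∀ U : UGroup d, Commute (tensorPow 3 (U : Matrix (ZMod d) (ZMod d) ℂ)) C)
    (v : ZMod d → ℂ) {r : ℝ} (hr : r ≠ 0) (hv : star v ⬝ᵥ v = (r : ℂ)) :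
    Commute (tensorDer (Matrix.vecMulVec v (star v))) C := by
  have hr' : (r : ℂ) ≠ 0 := by exact_mod_cast hr
  have hP : (Matrix.vecMulVec v (star v)).conjTranspose = Matrix.vecMulVec v (star v) := by
    rw [Matrix.conjTranspose_vecMulVec, star_star]
  have hPP : Matrix.vecMulVec v (star v) * Matrix.vecMulVec v (star v) =
      (r : ℂ) • Matrix.vecMulVec v (star v) := by
    rw [Matrix.vecMulVec_mul_vecMulVec, hv, Matrix.vecMulVec_smul]
  set P := Matrix.vecMulVec v (star v)
  have h := commute_tensorDer_of_involution C hC (H := 1 + (-(2 / r : ℂ)) • P) ?_ ?_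
  · rw [tensorDer_add, tensorDer_one, tensorDer_smul] at h
    have h1 := (h.sub_left ((Commute.one_left C).smul_left (3 : ℂ))).smul_left (-(2 / r : ℂ))⁻¹
    rwa [add_sub_cancel_left, smul_smul, inv_mul_cancel₀ (by simpa using hr), one_smul] at h1
  · rw [Matrix.conjTranspose_add, Matrix.conjTranspose_one, Matrix.conjTranspose_smul, hP]
    simp
  · rw [Matrix.add_mul, Matrix.mul_add, Matrix.one_mul, Matrix.one_mul, Matrix.mul_add,
      Matrix.mul_one, Matrix.smul_mul, Matrix.mul_smul, hPP, smul_smul, smul_smul, add_assoc,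
      ← add_smul, ← add_smul]
    convert add_zero _
    convert zero_smul ℂ _
    field_simp
    ring

/-- An operator commuting with all `U^{⊗3}` commutes with the action of all matrix units. -/
theorem commute_tensorDer_single (C : Matrix (Fin 3 → ZMod d) (Fin 3 → ZMod d) ℂ)
    (hC : ∀ U : UGroup d, Commute (tensorPow 3 (U : Matrix (ZMod d) (ZMod d) ℂ)) C)
    (i j : ZMod d) : Commute (tensorDer (Matrix.single i j 1)) C := by
  have hdiag : ∀ i : ZMod d, Commute (tensorDer (Matrix.single i i 1)) C := by
    intro i
    have h := commute_tensorDer_vecMulVec C hC (Pi.single i 1) one_ne_zero (by simp)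
    rw [← Pi.single_star, star_one] at h
    rwa [Matrix.single_eq_single_vecMulVec_single]
  rcases eq_or_ne i j with rfl | hij
  · exact hdiag i
  -- Polarization: apply the rank-one case to `e_i + z e_j`, of squared norm 2, and remove the two
  -- diagonal terms.
  have key : ∀ z : ℂ, star z * z = 1 →
      Commute (tensorDer (star z • Matrix.single i j 1 + z • Matrix.single j i 1)) C := by
    intro z hz
    have h := commute_tensorDer_vecMulVec C hC (Pi.single i 1 + z • Pi.single j 1)
      (two_ne_zero (α := ℝ)) ?_
    · have h1 := (h.sub_left (hdiag i)).sub_left (hdiag j)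
      refine (congrArg (fun M => Commute M C) ?_).mp h1
      symm
      rw [sub_sub, ← tensorDer_add, eq_sub_iff_add_eq, ← tensorDer_add]
      congr 1
      simp only [star_add, star_smul, ← Pi.single_star, star_one, Matrix.add_vecMulVec,
        Matrix.vecMulVec_add, Matrix.smul_vecMulVec, Matrix.vecMulVec_smul,
        ← Matrix.single_eq_single_vecMulVec_single, smul_add, smul_smul, hz, one_smul]
      abel
    · simp [star_add, star_smul, dotProduct_add, hij, hij.symm]
      rw [mul_comm]
      have : (starRingEnd ℂ) z * z = 1 := hz
      rw [this]; norm_num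
  have h1 := key 1 (by simp)
  have h2 := key Complex.I (by simp)
  -- The case `z = 1` plus `i` times the case `z = i` cancels `E_ji` and doubles `E_ij`.
  have h3 := (h1.add_left (h2.smul_left Complex.I)).smul_left (2⁻¹ : ℂ)
  rw [← tensorDer_smul, ← tensorDer_add, ← tensorDer_smul] at h3
  refine (congrArg (fun M => Commute (tensorDer M) C) ?_).mp h3
  symm
  ext a b
  simp only [Matrix.smul_apply, Matrix.add_apply, smul_eq_mul, star_one]
  have : star Complex.I = -Complex.I := Complex.conj_I
  rw [this]
  linear_combination (1 / 2 * Matrix.single i j (1 : ℂ) a b - 1 / 2 * Matrix.single j i (1 : ℂ) a b) *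
    Complex.I_mul_I

end Commutant

/-! ### Schur–Weyl duality for three copies -/

section Span

/-- The basis vector `|x, y, z⟩`. -/
def ket {n : Type*} [DecidableEq n] (x y z : n) : (Fin 3 → n) → ℂ := Pi.single ![x, y, z] 1

theorem ket_apply {n : Type*} [DecidableEq n] (x y z : n) (a : Fin 3 → n) :
    ket x y z a = (1 : Matrix n n ℂ) (a 0) x * (1 : Matrix n n ℂ) (a 1) y *
      (1 : Matrix n n ℂ) (a 2) z := by
  rw [ket, Pi.single_apply, ← Matrix.one_apply]
  exact one_apply_fin_three a ![x, y, z]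

theorem tensorDer_single_mulVec_ket {n : Type*} [Fintype n] [DecidableEq n] (i j x y z : n) :
    tensorDer (Matrix.single i j 1) *ᵥ ket x y z =
      (if x = j then ket i y z else 0) + (if y = j then ket x i z else 0) +
        (if z = j then ket x y i else 0) := by
  ext a
  have h : ∀ c w : n, Matrix.single i j (1 : ℂ) c w =
      if w = j then (1 : Matrix n n ℂ) c i else 0 := by
    intro c w
    simp only [Matrix.single_apply, Matrix.one_apply]
    split_ifs <;> simp_all
  have h2 : (tensorDer (Matrix.single i j 1) *ᵥ ket x y z) a =
      Matrix.single i j 1 (a 0) x * (1 : Matrix n n ℂ) (a 1) y * (1 : Matrix n n ℂ) (a 2) z +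
      (1 : Matrix n n ℂ) (a 0) x * Matrix.single i j 1 (a 1) y * (1 : Matrix n n ℂ) (a 2) z +
      (1 : Matrix n n ℂ) (a 0) x * (1 : Matrix n n ℂ) (a 1) y * Matrix.single i j 1 (a 2) z := by
    rw [ket, Matrix.mulVec_single_one]
    rfl
  rw [h2]
  simp only [h, Pi.add_apply, apply_ite (fun f : (Fin 3 → n) → ℂ => f a), Pi.zero_apply,
    ket_apply]
  split_ifs <;> ring

variable {d : ℕ} [NeZero d]

theorem permOp_mulVec_single (π : Equiv.Perm (Fin 3)) (s : Fin 3 → ZMod d) :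
    permOp d π *ᵥ Pi.single s 1 = Pi.single (s ∘ π) 1 := by
  ext a
  rw [Matrix.mulVec_single_one]
  simp [permOp, Pi.single_apply]

theorem commute_tensorPow_permOp (M : Matrix (ZMod d) (ZMod d) ℂ) (π : Equiv.Perm (Fin 3)) :
    Commute (tensorPow 3 M) (permOp d π) := by
  ext a s
  have h : ∀ c : Fin 3 → ZMod d, a = c ∘ π ↔ c = a ∘ ⇑π⁻¹ := by
    intro c
    constructor
    · rintro rfl; ext i; simp
    · rintro rfl; ext i; simp
  simp only [Matrix.mul_apply, permOp, Matrix.of_apply, h, mul_ite, mul_one, mul_zero, ite_mul,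
    one_mul, zero_mul, Finset.sum_ite_eq', Finset.mem_univ, if_true, tensorPow]
  rw [← Equiv.prod_comp π fun i => M ((a ∘ ⇑π⁻¹) i) (s i)]
  simp

/-- The span of the permutation operators. -/
def permSpan (d : ℕ) [NeZero d] : Submodule ℂ (Matrix (Fin 3 → ZMod d) (Fin 3 → ZMod d) ℂ) :=
  Submodule.span ℂ (Set.range (permOp d))

theorem permOp_mem_permSpan (π : Equiv.Perm (Fin 3)) : permOp d π ∈ permSpan d :=
  Submodule.subset_span ⟨π, rfl⟩

theorem commute_tensorPow_of_mem_permSpan {C : Matrix (Fin 3 → ZMod d) (Fin 3 → ZMod d) ℂ}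
    (hC : C ∈ permSpan d) (M : Matrix (ZMod d) (ZMod d) ℂ) : Commute (tensorPow 3 M) C := by
  induction hC using Submodule.span_induction with
  | mem x hx => obtain ⟨π, rfl⟩ := hx; exact commute_tensorPow_permOp M π
  | zero => exact Commute.zero_right _
  | add x y _ _ hx hy => exact hx.add_right hy
  | smul c x _ hx => exact hx.smul_right c

theorem mulVec_eq_zero_of_commute {m : Type*} [Fintype m] {C L : Matrix m m ℂ} (h : Commute L C)
    {v : m → ℂ} (hv : C *ᵥ v = 0) : C *ᵥ (L *ᵥ v) = 0 := by
  rw [Matrix.mulVec_mulVec, ← h.eq, ← Matrix.mulVec_mulVec, hv, Matrix.mulVec_zero]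

theorem eq_zero_of_mulVec_ket {n : Type*} [Fintype n] [DecidableEq n]
    {C : Matrix (Fin 3 → n) (Fin 3 → n) ℂ} (h : ∀ x y z, C *ᵥ ket x y z = 0) : C = 0 := by
  ext a b
  have hb : b = ![b 0, b 1, b 2] := by ext i; fin_cases i <;> rfl
  have := congrFun (h (b 0) (b 1) (b 2)) a
  rwa [ket, ← hb, Matrix.mulVec_single_one] at this

/-- The commutant preserves weight spaces. -/
theorem apply_eq_zero_of_count_ne {C : Matrix (Fin 3 → ZMod d) (Fin 3 → ZMod d) ℂ}
    (hC : ∀ i j : ZMod d, Commute (tensorDer (Matrix.single i j 1)) C) {a b : Fin 3 → ZMod d}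
    (i : ZMod d) (hi : (∑ k, if a k = i then (1 : ℂ) else 0) ≠ ∑ k, if b k = i then (1 : ℂ) else 0) :
    C a b = 0 := by
  -- The derivation of `E_ii` is diagonal and counts the occurrences of `i`; an operator commuting
  -- with it cannot connect different counts.
  have hD : tensorDer (Matrix.single i i 1) =
      Matrix.diagonal fun a : Fin 3 → ZMod d => ∑ k, if a k = i then (1 : ℂ) else 0 := by
    ext a b
    rw [Matrix.diagonal_apply]
    have h := one_apply_fin_three a b
    rw [Matrix.one_apply] at h
    have h2 : ∀ c w : ZMod d, Matrix.single i i (1 : ℂ) c w =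
        (if c = i then 1 else 0) * (1 : Matrix (ZMod d) (ZMod d) ℂ) c w := by
      intro c w
      rw [Matrix.single_apply, Matrix.one_apply]
      by_cases h1 : c = i
      · subst h1
        by_cases h2 : c = w <;> simp [h2]
      · simp [h1, Ne.symm h1]
    simp only [tensorDer, Matrix.of_apply, h2, Fin.sum_univ_three]
    trans ((if a 0 = i then (1 : ℂ) else 0) + (if a 1 = i then (1 : ℂ) else 0) +
      (if a 2 = i then (1 : ℂ) else 0)) * if a = b then (1 : ℂ) else 0
    · rw [h]; ring
    · rw [mul_ite, mul_one, mul_zero]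
  have h := congrFun (congrFun (hC i i).eq a) b
  rw [hD, Matrix.diagonal_mul, Matrix.mul_diagonal, mul_comm, ← sub_eq_zero, ← mul_sub] at h
  exact (mul_eq_zero.mp h).resolve_right (sub_ne_zero.mpr hi)

/-- Every value of `b` must occur in `a`. A choice of positions where it occurs is injective because
`b` is, hence a permutation. -/
theorem exists_eq_comp_perm {n : Type*} [DecidableEq n] {a b : Fin 3 → n}
    (hb : Function.Injective b)
    (h : ∀ i, (∑ k, if a k = i then (1 : ℂ) else 0) = ∑ k, if b k = i then (1 : ℂ) else 0) :
    ∃ π : Equiv.Perm (Fin 3), a = b ∘ π := by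
  have h1 : ∀ k, ∃ l, a l = b k := by
    intro k
    by_contra! hk
    have h2 := h (b k)
    simp only [hb.eq_iff, Finset.sum_ite_eq', Finset.mem_univ, if_true, if_neg (hk _)] at h2
    simp at h2
  choose f hf using h1
  have hinj : Function.Injective f := fun x y hxy => hb (by rw [← hf, ← hf, hxy])
  refine ⟨(Equiv.ofBijective f (Finite.injective_iff_bijective.mp hinj))⁻¹, ?_⟩
  ext k
  have hk := (Equiv.ofBijective f (Finite.injective_iff_bijective.mp hinj)).apply_symm_apply k
  rw [Equiv.ofBijective_apply] at hk
  rw [Function.comp_apply, Equiv.Perm.inv_def, ← hf, hk]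

/-- For distinct `p, q, r` the vector `|pqr⟩` is cyclic for the matrix-unit derivations. By weight
preservation `C|pqr⟩` is a combination of permuted kets, so a combination `S` of permutation
operators agrees with `C` there, and then everywhere. -/
theorem mem_permSpan_of_three {C : Matrix (Fin 3 → ZMod d) (Fin 3 → ZMod d) ℂ}
    (hC : ∀ U : UGroup d, Commute (tensorPow 3 (U : Matrix (ZMod d) (ZMod d) ℂ)) C)
    {p q r : ZMod d} (hpq : p ≠ q) (hpr : p ≠ r) (hqr : q ≠ r) : C ∈ permSpan d := by
  have hL := commute_tensorDer_single C hC
  set b : Fin 3 → ZMod d := ![p, q, r] with hb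
  have hbinj : Function.Injective b := by
    intro x y
    fin_cases x <;> fin_cases y <;> simp [hb, hpq, hpr, hqr, hpq.symm, hpr.symm, hqr.symm]
  set S := ∑ π : Equiv.Perm (Fin 3), C (b ∘ π) b • permOp d π with hS
  have hSmem : S ∈ permSpan d :=
    Submodule.sum_mem _ fun π _ => Submodule.smul_mem _ _ (permOp_mem_permSpan π)
  have hL' : ∀ i j : ZMod d, Commute (tensorDer (Matrix.single i j 1)) (C - S) := fun i j =>
    (hL i j).sub_right (commute_tensorDer_single S
      (fun U => commute_tensorPow_of_mem_permSpan hSmem _) i j)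
  have h0 : (C - S) *ᵥ ket p q r = 0 := by
    rw [Matrix.sub_mulVec, sub_eq_zero, ket, ← hb, hS, Matrix.sum_mulVec]
    simp only [Matrix.smul_mulVec, permOp_mulVec_single]
    ext a
    rw [Matrix.mulVec_single_one, Finset.sum_apply]
    simp only [Pi.smul_apply, Pi.single_apply, smul_eq_mul, Matrix.col_apply, mul_ite, mul_one,
      mul_zero]
    by_cases ha : ∃ π : Equiv.Perm (Fin 3), a = b ∘ π
    · obtain ⟨π, rfl⟩ := ha
      rw [Finset.sum_eq_single π]
      · simp
      · intro σ _ hσ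
        rw [if_neg]
        intro h
        exact hσ (Equiv.ext fun k => (hbinj (congrFun h k)).symm)
      · simp
    · rw [Finset.sum_eq_zero fun σ _ => if_neg fun h => ha ⟨σ, h⟩]
      by_contra hne
      apply ha
      refine exists_eq_comp_perm hbinj fun i => ?_
      by_contra hi
      exact hne (apply_eq_zero_of_count_ne hL i hi)
  have h1 : ∀ x, (C - S) *ᵥ ket x q r = 0 := by
    intro x
    have h := mulVec_eq_zero_of_commute (hL' x p) h0
    simpa [tensorDer_single_mulVec_ket, hpq.symm, hpr.symm] using h
  -- `E_yq` sends `|x q r⟩` to `|x y r⟩`, plus `|y q r⟩` when `x = q`; the extra term is already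
  -- killed. The next replacement works the same way.
  have h2 : ∀ x y, (C - S) *ᵥ ket x y r = 0 := by
    intro x y
    have h := mulVec_eq_zero_of_commute (hL' y q) (h1 x)
    rw [tensorDer_single_mulVec_ket, Matrix.mulVec_add, Matrix.mulVec_add] at h
    split_ifs at h <;> simp_all
  have h3 : ∀ x y z, (C - S) *ᵥ ket x y z = 0 := by
    intro x y z
    have h := mulVec_eq_zero_of_commute (hL' z r) (h2 x y)
    rw [tensorDer_single_mulVec_ket, Matrix.mulVec_add, Matrix.mulVec_add] at h
    split_ifs at h <;> simp_all
  rw [sub_eq_zero.mp (eq_zero_of_mulVec_ket h3)]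
  exact hSmem

theorem permOp_mulVec_ket (π : Equiv.Perm (Fin 3)) (x y z : ZMod d) :
    permOp d π *ᵥ ket x y z = ket (![x, y, z] (π 0)) (![x, y, z] (π 1)) (![x, y, z] (π 2)) := by
  rw [ket, permOp_mulVec_single, ket]
  congr 1
  ext i
  fin_cases i <;> rfl

/-- With two labels there is no ket with distinct entries. Here `C` is determined by its values on
`|ppq⟩` and `|pqp⟩`: six coefficients with one relation. Five permutations suffice, the sixth being
redundant since antisymmetrization over three copies of a qubit vanishes. -/
theorem mem_permSpan_of_two {C : Matrix (Fin 3 → ZMod d) (Fin 3 → ZMod d) ℂ}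
    (hC : ∀ U : UGroup d, Commute (tensorPow 3 (U : Matrix (ZMod d) (ZMod d) ℂ)) C)
    {p q : ZMod d} (hpq : p ≠ q) (hall : ∀ x, x = p ∨ x = q) : C ∈ permSpan d := by
  have hL := commute_tensorDer_single C hC
  have hcol : ∀ b : Fin 3 → ZMod d, (∑ k, if b k = q then (1 : ℂ) else 0) = 1 →
      C *ᵥ Pi.single b 1 = C ![q, p, p] b • ket q p p + C ![p, q, p] b • ket p q p +
        C ![p, p, q] b • ket p p q := by
    intro b hb
    ext a
    rw [Matrix.mulVec_single_one, Matrix.col_apply]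
    have ha : a = ![a 0, a 1, a 2] := by ext i; fin_cases i <;> rfl
    by_cases hq : (∑ k, if a k = q then (1 : ℂ) else 0) = 1
    · rw [Fin.sum_univ_three] at hq
      rw [ha]
      rcases hall (a 0) with h0 | h0 <;> rcases hall (a 1) with h1 | h1 <;>
        rcases hall (a 2) with h2 | h2 <;>
        simp [h0, h1, h2, ket_apply, hpq, hpq.symm, Matrix.one_apply] at hq ⊢
    · rw [apply_eq_zero_of_count_ne hL q (by rw [hb]; exact hq)]
      rw [Fin.sum_univ_three] at hq
      rcases hall (a 0) with h0 | h0 <;> rcases hall (a 1) with h1 | h1 <;>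
        rcases hall (a 2) with h2 | h2 <;>
        simp [h0, h1, h2, ket_apply, hpq, hpq.symm, Matrix.one_apply] at hq ⊢
  have hcol1 := hcol ![p, p, q] (by rw [Fin.sum_univ_three]; simp [hpq])
  have hcol2 := hcol ![p, q, p] (by rw [Fin.sum_univ_three]; simp [hpq])
  rw [← ket] at hcol1 hcol2
  set a0 := C ![q, p, p] ![p, p, q]
  set a1 := C ![p, q, p] ![p, p, q]
  set a2 := C ![p, p, q] ![p, p, q]
  set b0 := C ![q, p, p] ![p, q, p]
  set b1 := C ![p, q, p] ![p, q, p]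
  set b2 := C ![p, p, q] ![p, q, p]
  -- `E_pq` sends each ket with exactly one `q` to `|ppp⟩`, so both sums are the eigenvalue of `C`
  -- on `|ppp⟩`.
  have hsum : a0 + a1 + a2 = b0 + b1 + b2 := by
    have e1 : tensorDer (Matrix.single p q 1) *ᵥ ket p p q = ket p p p := by
      simp [tensorDer_single_mulVec_ket, hpq]
    have e2 : tensorDer (Matrix.single p q 1) *ᵥ ket p q p = ket p p p := by
      simp [tensorDer_single_mulVec_ket, hpq]
    have e3 : tensorDer (Matrix.single p q 1) *ᵥ ket q p p = ket p p p := by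
      simp [tensorDer_single_mulVec_ket, hpq]
    have f1 : C *ᵥ ket p p p = (a0 + a1 + a2) • ket p p p := by
      conv_lhs => rw [← e1, Matrix.mulVec_mulVec, ← (hL p q).eq, ← Matrix.mulVec_mulVec, hcol1]
      simp only [Matrix.mulVec_add, Matrix.mulVec_smul, e1, e2, e3, add_smul]
    have f2 : C *ᵥ ket p p p = (b0 + b1 + b2) • ket p p p := by
      conv_lhs => rw [← e2, Matrix.mulVec_mulVec, ← (hL p q).eq, ← Matrix.mulVec_mulVec, hcol2]
      simp only [Matrix.mulVec_add, Matrix.mulVec_smul, e1, e2, e3, add_smul]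
    have f3 := congrFun (f1.symm.trans f2) ![p, p, p]
    simpa [ket] using f3
  -- These coefficients solve `S|ppq⟩ = C|ppq⟩` and `S|pqp⟩ = C|pqp⟩`; `hsum` makes the system
  -- consistent.
  set S := (b1 - a0) • permOp d 1 + (b0 - a1 + b2) • permOp d (Equiv.swap 0 1) +
    b2 • permOp d (Equiv.swap 1 2) + a0 • permOp d (Equiv.swap 0 2) +
    (a1 - b2) • permOp d (finRotate 3) with hS
  have hSmem : S ∈ permSpan d := by
    refine Submodule.add_mem _ (Submodule.add_mem _ (Submodule.add_mem _ (Submodule.add_mem _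
      ?_ ?_) ?_) ?_) ?_ <;>
      exact Submodule.smul_mem _ _ (permOp_mem_permSpan _)
  have hL' : ∀ i j : ZMod d, Commute (tensorDer (Matrix.single i j 1)) (C - S) := fun i j =>
    (hL i j).sub_right (commute_tensorDer_single S
      (fun U => commute_tensorPow_of_mem_permSpan hSmem _) i j)
  have hSket : ∀ x y z, S *ᵥ ket x y z = (b1 - a0) • ket x y z + (b0 - a1 + b2) • ket y x z +
      b2 • ket x z y + a0 • ket z y x + (a1 - b2) • ket y z x := by
    intro x y z
    rw [hS]
    simp only [Matrix.add_mulVec, Matrix.smul_mulVec, permOp_mulVec_ket]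
    rfl
  have h1 : (C - S) *ᵥ ket p p q = 0 := by
    rw [Matrix.sub_mulVec, hcol1, hSket]
    linear_combination (norm := module) hsum • ket p p q
  have h2 : (C - S) *ᵥ ket p q p = 0 := by
    rw [Matrix.sub_mulVec, hcol2, hSket]
    module
  have hstep : ∀ i j x y z, (C - S) *ᵥ ket x y z = 0 →
      (C - S) *ᵥ (if x = j then ket i y z else 0) + (C - S) *ᵥ (if y = j then ket x i z else 0) +
        (C - S) *ᵥ (if z = j then ket x y i else 0) = 0 := by
    intro i j x y z h
    have h := mulVec_eq_zero_of_commute (hL' i j) h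
    rwa [tensorDer_single_mulVec_ket, Matrix.mulVec_add, Matrix.mulVec_add] at h
  have h3 : (C - S) *ᵥ ket p p p = 0 := by
    simpa [hpq] using hstep p q p p q h1
  have h4 : (C - S) *ᵥ ket q p p = 0 := by
    simpa [h1, h2] using hstep q p p p p h3
  -- Applying `E_qp` to the three one-`q` kets gives the pairwise sums of the two-`q` kets, an
  -- invertible system.
  have k1 := hstep q p p p q h1
  have k2 := hstep q p p q p h2
  have k3 := hstep q p q p p h4
  simp only [if_true, if_neg hpq.symm, Matrix.mulVec_zero, add_zero, zero_add] at k1 k2 k3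
  have h5 : (C - S) *ᵥ ket q p q = 0 := by
    linear_combination (norm := module) (1 / 2 : ℂ) • k1 - (1 / 2 : ℂ) • k2 + (1 / 2 : ℂ) • k3
  have h6 : (C - S) *ᵥ ket p q q = 0 := by
    linear_combination (norm := module) (1 / 2 : ℂ) • k1 + (1 / 2 : ℂ) • k2 - (1 / 2 : ℂ) • k3
  have h7 : (C - S) *ᵥ ket q q p = 0 := by
    linear_combination (norm := module) (-1 / 2 : ℂ) • k1 + (1 / 2 : ℂ) • k2 + (1 / 2 : ℂ) • k3
  have h8 : (C - S) *ᵥ ket q q q = 0 := by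
    simpa [hpq.symm] using hstep q p q q p h7
  have h9 : ∀ x y z, (C - S) *ᵥ ket x y z = 0 := by
    intro x y z
    rcases hall x with rfl | rfl <;> rcases hall y with rfl | rfl <;>
      rcases hall z with rfl | rfl <;> assumption
  rw [sub_eq_zero.mp (eq_zero_of_mulVec_ket h9)]
  exact hSmem

/-- The commutant of `{U ⊗ U ⊗ U}` is spanned by the permutation operators. -/
theorem mem_permSpan_of_commute (hd : 2 ≤ d) {C : Matrix (Fin 3 → ZMod d) (Fin 3 → ZMod d) ℂ}
    (hC : ∀ U : UGroup d, Commute (tensorPow 3 (U : Matrix (ZMod d) (ZMod d) ℂ)) C) :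
    C ∈ permSpan d := by
  rcases hd.eq_or_lt with rfl | h3
  · exact mem_permSpan_of_two hC (p := 0) (q := 1) (by decide) (by decide)
  · have hne : ∀ a b : ℕ, a < d → b < d → a ≠ b → (a : ZMod d) ≠ b := by
      intro a b ha hb hab h
      rw [ZMod.natCast_eq_natCast_iff', Nat.mod_eq_of_lt ha, Nat.mod_eq_of_lt hb] at h
      exact hab h
    exact mem_permSpan_of_three hC (hne 0 1 (by omega) (by omega) (by omega))
      (hne 0 2 (by omega) (by omega) (by omega)) (hne 1 2 (by omega) (by omega) (by omega))

end Span

/-! ### Trace criterion for the local twirl -/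

section Criterion

variable {d : ℕ} [NeZero d]

/-- The span of the products `W_σ ⊗ W_τ`. -/
def permPairSpan (d : ℕ) [NeZero d] : Submodule ℂ (Matrix (Idx d) (Idx d) ℂ) :=
  Submodule.span ℂ (Set.range fun q : Equiv.Perm (Fin 3) × Equiv.Perm (Fin 3) =>
    permOp d q.1 ⊗ₖ permOp d q.2)

theorem kronecker_mem_permPairSpan {X Y : Matrix (Fin 3 → ZMod d) (Fin 3 → ZMod d) ℂ}
    (hX : X ∈ permSpan d) (hY : Y ∈ permSpan d) : X ⊗ₖ Y ∈ permPairSpan d := by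
  induction hX using Submodule.span_induction with
  | mem x hx =>
    obtain ⟨σ, rfl⟩ := hx
    induction hY using Submodule.span_induction with
    | mem y hy =>
      obtain ⟨τ, rfl⟩ := hy
      exact Submodule.subset_span ⟨(σ, τ), rfl⟩
    | zero => rw [Matrix.kronecker_zero]; exact Submodule.zero_mem _
    | add x y _ _ hx hy => rw [Matrix.kronecker_add]; exact Submodule.add_mem _ hx hy
    | smul c x _ hx => rw [Matrix.kronecker_smul]; exact Submodule.smul_mem _ _ hx
  | zero => rw [Matrix.zero_kronecker]; exact Submodule.zero_mem _
  | add x y _ _ hx hy => rw [Matrix.add_kronecker]; exact Submodule.add_mem _ hx hy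
  | smul c x _ hx => rw [Matrix.smul_kronecker]; exact Submodule.smul_mem _ _ hx

theorem twirl_mem_permSpan (hd : 2 ≤ d) {μ : Measure (UGroup d)} (hμ : IsUnitaryDesign 3 μ)
    (X : Matrix (Fin 3 → ZMod d) (Fin 3 → ZMod d) ℂ) : twirl 3 μ X ∈ permSpan d := by
  rw [hμ]
  exact mem_permSpan_of_commute hd fun U => commute_tensorPow_twirl_haarU 3 X U

variable {μA μB : Measure (UGroup d)} [IsProbabilityMeasure μA] [IsProbabilityMeasure μB]

theorem localTwirl_mem_permPairSpan (hd : 2 ≤ d) (hA : IsUnitaryDesign 3 μA)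
    (hB : IsUnitaryDesign 3 μB) (X : Matrix (Idx d) (Idx d) ℂ) :
    localTwirl μA μB X ∈ permPairSpan d := by
  rw [localTwirl_eq_sum]
  exact Submodule.sum_mem _ fun s _ => Submodule.sum_mem _ fun t _ => Submodule.smul_mem _ _
    (kronecker_mem_permPairSpan (twirl_mem_permSpan hd hA _) (twirl_mem_permSpan hd hB _))

/-- Permutation operators commute with tensor powers, so conjugating `X` is invisible in the trace.
No design property is needed. -/
theorem trace_mul_localTwirl {Z : Matrix (Idx d) (Idx d) ℂ} (hZ : Z ∈ permPairSpan d)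
    (X : Matrix (Idx d) (Idx d) ℂ) :
    (Z * localTwirl μA μB X).trace = (Z * X).trace := by
  induction hZ using Submodule.span_induction with
  | mem x hx =>
    obtain ⟨⟨σ, τ⟩, rfl⟩ := hx
    have key : ∀ Y Y' : Matrix (Fin 3 → ZMod d) (Fin 3 → ZMod d) ℂ,
        ((permOp d σ ⊗ₖ permOp d τ) * (twirl 3 μA Y ⊗ₖ twirl 3 μB Y')).trace =
          ((permOp d σ ⊗ₖ permOp d τ) * (Y ⊗ₖ Y')).trace := by
      intro Y Y'
      have h1 := trace_mul_twirl 3 μA (permOp d σ) Y fun U => commute_tensorPow_permOp U.1 σ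
      have h2 := trace_mul_twirl 3 μB (permOp d τ) Y' fun U => commute_tensorPow_permOp U.1 τ
      rw [← Matrix.mul_kronecker_mul, ← Matrix.mul_kronecker_mul, Matrix.trace_kronecker,
        Matrix.trace_kronecker, h1, h2]
    rw [localTwirl_eq_sum]
    conv_rhs => rw [eq_sum_smul_kronecker X]
    rw [Matrix.mul_sum, Matrix.mul_sum, Matrix.trace_sum, Matrix.trace_sum]
    refine Finset.sum_congr rfl fun s _ => ?_
    rw [Matrix.mul_sum, Matrix.mul_sum, Matrix.trace_sum, Matrix.trace_sum]
    refine Finset.sum_congr rfl fun t _ => ?_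
    rw [Matrix.mul_smul, Matrix.mul_smul, Matrix.trace_smul, Matrix.trace_smul, key]
  | zero => simp
  | add x y _ _ hx hy => rw [Matrix.add_mul, Matrix.add_mul, Matrix.trace_add, Matrix.trace_add,
      hx, hy]
  | smul c x _ hx => rw [Matrix.smul_mul, Matrix.smul_mul, Matrix.trace_smul, Matrix.trace_smul, hx]

theorem conjTranspose_permOp (π : Equiv.Perm (Fin 3)) :
    (permOp d π).conjTranspose = permOp d π⁻¹ := by
  ext a s
  have h : s = a ∘ π ↔ a = s ∘ ⇑π⁻¹ := by
    constructor
    · rintro rfl; ext i; simp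
    · rintro rfl; ext i; simp
  simp only [Matrix.conjTranspose_apply, permOp, Matrix.of_apply, h]
  split_ifs <;> simp

/-- Adjoints only invert the permutations, so the hypothesis makes `Z` orthogonal to the whole span,
in particular to itself. This avoids inverting a Gram matrix, which is singular for `d = 2`. -/
theorem eq_zero_of_trace_permOp_mul {Z : Matrix (Idx d) (Idx d) ℂ} (hZ : Z ∈ permPairSpan d)
    (h : ∀ σ τ, ((permOp d σ ⊗ₖ permOp d τ) * Z).trace = 0) : Z = 0 := by
  have key : ∀ Y ∈ permPairSpan d, (Y.conjTranspose * Z).trace = 0 := by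
    intro Y hY
    induction hY using Submodule.span_induction with
    | mem x hx =>
      obtain ⟨⟨σ, τ⟩, rfl⟩ := hx
      rw [Matrix.conjTranspose_kronecker, conjTranspose_permOp, conjTranspose_permOp]
      exact h _ _
    | zero => simp
    | add x y _ _ hx hy =>
      rw [Matrix.conjTranspose_add, Matrix.add_mul, Matrix.trace_add, hx, hy, add_zero]
    | smul c x _ hx =>
      rw [Matrix.conjTranspose_smul, Matrix.smul_mul, Matrix.trace_smul, hx, smul_zero]
  exact Matrix.trace_conjTranspose_mul_self_eq_zero_iff.mp (key Z hZ)

/-- The local twirl of `X` is the element of the commutant with the same traces as `X`. -/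
theorem localTwirl_eq_of_trace (hd : 2 ≤ d) (hA : IsUnitaryDesign 3 μA)
    (hB : IsUnitaryDesign 3 μB) {X Y : Matrix (Idx d) (Idx d) ℂ} (hY : Y ∈ permPairSpan d)
    (h : ∀ σ τ, ((permOp d σ ⊗ₖ permOp d τ) * X).trace =
      ((permOp d σ ⊗ₖ permOp d τ) * Y).trace) : localTwirl μA μB X = Y := by
  rw [← sub_eq_zero]
  refine eq_zero_of_trace_permOp_mul
    (Submodule.sub_mem _ (localTwirl_mem_permPairSpan hd hA hB X) hY) fun σ τ => ?_
  rw [Matrix.mul_sub, Matrix.trace_sub,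
    trace_mul_localTwirl (kronecker_mem_permPairSpan (permOp_mem_permSpan σ)
      (permOp_mem_permSpan τ)), h, sub_self]

end Criterion

/-! ### Traces of permutation operators -/

section PermTraces

variable {d : ℕ} [NeZero d]

theorem sum_fin_three_fun {α : Type*} [Fintype α] (f : (Fin 3 → α) → ℂ) :
    ∑ y, f y = ∑ x, ∑ y, ∑ z, f ![x, y, z] := by
  let e : α × α × α ≃ (Fin 3 → α) :=
    { toFun := fun q => ![q.1, q.2.1, q.2.2]
      invFun := fun y => (y 0, y 1, y 2)
      left_inv := fun q => rfl
      right_inv := fun y => by ext i; fin_cases i <;> rfl }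
  rw [← e.sum_comp, Fintype.sum_prod_type]
  exact Finset.sum_congr rfl fun x _ => Fintype.sum_prod_type _

theorem perm_fin_three (σ : Equiv.Perm (Fin 3)) :
    σ = 1 ∨ σ = Equiv.swap 0 1 ∨ σ = Equiv.swap 0 2 ∨ σ = Equiv.swap 1 2 ∨ σ = finRotate 3 ∨
      σ = (finRotate 3)⁻¹ := by
  revert σ; decide

theorem swap_zero_one_values : (Equiv.swap 0 1 : Equiv.Perm (Fin 3)) 0 = 1 ∧
    (Equiv.swap 0 1 : Equiv.Perm (Fin 3)) 1 = 0 ∧ (Equiv.swap 0 1 : Equiv.Perm (Fin 3)) 2 = 2 := by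
  decide

theorem swap_zero_two_values : (Equiv.swap 0 2 : Equiv.Perm (Fin 3)) 0 = 2 ∧
    (Equiv.swap 0 2 : Equiv.Perm (Fin 3)) 1 = 1 ∧ (Equiv.swap 0 2 : Equiv.Perm (Fin 3)) 2 = 0 := by
  decide

theorem swap_one_two_values : (Equiv.swap 1 2 : Equiv.Perm (Fin 3)) 0 = 0 ∧
    (Equiv.swap 1 2 : Equiv.Perm (Fin 3)) 1 = 2 ∧ (Equiv.swap 1 2 : Equiv.Perm (Fin 3)) 2 = 1 := by
  decide

theorem finRotate_three_values : finRotate 3 0 = 1 ∧ finRotate 3 1 = 2 ∧ finRotate 3 2 = 0 := by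
  decide

theorem finRotate_three_inv_values : (finRotate 3)⁻¹ 0 = 2 ∧ (finRotate 3)⁻¹ 1 = 0 ∧
    (finRotate 3)⁻¹ 2 = 1 := by
  decide

theorem vec_three_values {α : Type*} (x y z : α) :
    (![x, y, z] : Fin 3 → α) 0 = x ∧ (![x, y, z] : Fin 3 → α) 1 = y ∧
      (![x, y, z] : Fin 3 → α) 2 = z :=
  ⟨rfl, rfl, rfl⟩

theorem permOp_mul_permOp (σ τ : Equiv.Perm (Fin 3)) :
    permOp d σ * permOp d τ = permOp d (τ * σ) := by
  ext a s
  simp only [Matrix.mul_apply, permOp, Matrix.of_apply, mul_ite, mul_one, mul_zero,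
    Finset.sum_ite_eq', Finset.mem_univ, if_true, Equiv.Perm.coe_mul, Function.comp_assoc]
  congr

theorem trace_permOp_mul_diagonal (σ : Equiv.Perm (Fin 3)) (f : (Fin 3 → ZMod d) → ℂ) :
    (permOp d σ * Matrix.diagonal f).trace = ∑ a, if a = a ∘ σ then f a else 0 := by
  simp [Matrix.trace, permOp, Matrix.mul_diagonal]

theorem trace_permOp_mul_diagonal_eq_sum (σ : Equiv.Perm (Fin 3)) (f : (Fin 3 → ZMod d) → ℂ) :
    (permOp d σ * Matrix.diagonal f).trace = ∑ x, ∑ y, ∑ z,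
      if x = ![x, y, z] (σ 0) ∧ y = ![x, y, z] (σ 1) ∧ z = ![x, y, z] (σ 2) then f ![x, y, z]
      else 0 := by
  rw [trace_permOp_mul_diagonal, sum_fin_three_fun]
  refine Finset.sum_congr rfl fun x _ => Finset.sum_congr rfl fun y _ =>
    Finset.sum_congr rfl fun z _ => ?_
  congr 1
  rw [funext_iff, Fin.forall_fin_succ, Fin.forall_fin_succ, Fin.forall_fin_succ]
  simp

/-- One free index per cycle of `σ`. -/
theorem trace_permOp (σ : Equiv.Perm (Fin 3)) : (permOp d σ).trace =
    if σ = 1 then (d : ℂ) ^ 3 else if σ = finRotate 3 ∨ σ = (finRotate 3)⁻¹ then (d : ℂ)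
    else (d : ℂ) ^ 2 := by
  have h := trace_permOp_mul_diagonal_eq_sum (d := d) σ fun _ => 1
  rw [Matrix.diagonal_one, Matrix.mul_one] at h
  rw [h]
  have e : ∀ x y : ZMod d, (x = y ∧ y = x) ↔ x = y := by
    intro x y; tauto
  rcases perm_fin_three σ with rfl | rfl | rfl | rfl | rfl | rfl
  · simp [vec_three_values]; ring
  · rw [if_neg (by decide), if_neg (by decide)]
    simp only [swap_zero_one_values, vec_three_values, and_true, e]
    simp
    ring
  · rw [if_neg (by decide), if_neg (by decide)]
    simp only [swap_zero_two_values, vec_three_values, true_and, e]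
    simp
    ring
  · rw [if_neg (by decide), if_neg (by decide)]
    simp only [swap_one_two_values, vec_three_values, true_and, e]
    simp
    ring
  · rw [if_neg (by decide), if_pos (by decide)]
    have e : ∀ x y z : ZMod d, (x = y ∧ y = z ∧ z = x) ↔ x = y ∧ y = z := by
      intro x y z
      constructor
      · tauto
      · rintro ⟨rfl, rfl⟩; tauto
    simp only [finRotate_three_values, vec_three_values, e, ite_and]
    simp
  · rw [if_neg (by decide), if_pos (by decide)]
    have e : ∀ x y z : ZMod d, (x = z ∧ y = x ∧ z = y) ↔ x = y ∧ y = z := by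
      intro x y z
      constructor
      · rintro ⟨rfl, rfl, _⟩; tauto
      · rintro ⟨rfl, rfl⟩; tauto
    simp only [finRotate_three_inv_values, vec_three_values, e, ite_and]
    simp

theorem trace_permOp_mul_Mminus (σ : Equiv.Perm (Fin 3)) : (permOp d σ * Mminus d).trace =
    if σ = finRotate 3 then (d : ℂ) - d ^ 3 else if σ = (finRotate 3)⁻¹ then (d : ℂ) ^ 3 - d
    else 0 := by
  rw [Mminus, W0, W1, Matrix.mul_sub, Matrix.trace_sub, permOp_mul_permOp, permOp_mul_permOp,
    trace_permOp, trace_permOp]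
  rcases perm_fin_three σ with rfl | rfl | rfl | rfl | rfl | rfl <;> simp (decide := true)

theorem trace_permOp_mul_Mplus (σ : Equiv.Perm (Fin 3)) : (permOp d σ * Mplus d).trace =
    if σ = 1 then 2 * (d : ℂ) else if σ = finRotate 3 ∨ σ = (finRotate 3)⁻¹ then (d : ℂ) + d ^ 3
    else 2 * (d : ℂ) ^ 2 := by
  rw [Mplus, W0, W1, Matrix.mul_add, Matrix.trace_add, permOp_mul_permOp, permOp_mul_permOp,
    trace_permOp, trace_permOp]
  rcases perm_fin_three σ with rfl | rfl | rfl | rfl | rfl | rfl <;> simp (decide := true) <;> ring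

end PermTraces

/-! ### Weights, and the traces of `O_+` -/

section Weight

theorem wt_eq {α : Type*} [DecidableEq α] (p : Fin 3 → α) :
    wt p = if p 0 = p 1 ∧ p 1 = p 2 then 3 else
      if p 0 = p 1 ∨ p 1 = p 2 ∨ p 0 = p 2 then 2 else 1 := by
  have huniv : (Finset.univ : Finset (Fin 3)) = {0, 1, 2} := by decide
  have h : wt p = max ((1 + if p 1 = p 0 then 1 else 0) + if p 2 = p 0 then 1 else 0)
      (max (((if p 0 = p 1 then 1 else 0) + 1) + if p 2 = p 1 then 1 else 0)
        (((if p 0 = p 2 then 1 else 0) + if p 1 = p 2 then 1 else 0) + 1)) := by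
    simp only [wt, Finset.card_filter, Fin.sum_univ_three]
    rw [huniv, Finset.sup_insert, Finset.sup_insert, Finset.sup_singleton]
    simp only [if_true]
  rw [h]
  by_cases h1 : p 0 = p 1 <;> by_cases h2 : p 1 = p 2 <;> by_cases h3 : p 0 = p 2 <;>
    simp_all [eq_comm]

theorem wt_comp_perm {α : Type*} [DecidableEq α] (p : Fin 3 → α) (π : Equiv.Perm (Fin 3)) :
    wt (p ∘ π) = wt p := by
  have h : ∀ (q : Fin 3 → α) (ρ : Equiv.Perm (Fin 3)), wt (q ∘ ρ) ≤ wt q := by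
    intro q ρ
    refine Finset.sup_le fun i _ => ?_
    have e : (Finset.univ.filter fun j => (q ∘ ρ) j = (q ∘ ρ) i).card =
        (Finset.univ.filter fun j => q j = q (ρ i)).card :=
      Finset.card_bij (fun j _ => ρ j) (by simp) (fun _ _ _ _ hab => ρ.injective hab)
        (fun b hb => ⟨ρ.symm b, by simpa using hb, by simp⟩)
    rw [e]
    exact Finset.le_sup (f := fun i => (Finset.univ.filter fun j => q j = q i).card)
      (Finset.mem_univ (ρ i))
  refine le_antisymm (h p π) ?_
  have := h (p ∘ π) π⁻¹
  rwa [Function.comp_assoc, ← Equiv.Perm.coe_mul, mul_inv_cancel, Equiv.Perm.coe_one,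
    Function.comp_id] at this

variable {d : ℕ} [NeZero d]

theorem trace_permOp_mul_Oplus (σ : Equiv.Perm (Fin 3)) :
    (permOp d σ * Oplus d).trace = (permOp d σ * Mplus d).trace := by
  rw [Oplus, trace_permOp_mul_diagonal_eq_sum, trace_permOp_mul_Mplus]
  -- Interpolation by equality indicators: the values are `2`, `1 - d`, `1 + d²` in weights 1, 2, 3.
  have hf : ∀ x y z : ZMod d, 1 + (-(d : ℂ)) ^ (wt ![x, y, z] - 1) =
      2 - (d + 1) * (if x = y then 1 else 0) - (d + 1) * (if y = z then 1 else 0) -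
        (d + 1) * (if x = z then 1 else 0) +
        (d ^ 2 + 3 * d + 2) * (if x = y then if y = z then 1 else 0 else 0) := by
    intro x y z
    rw [wt_eq]
    simp only [vec_three_values]
    by_cases h1 : x = y
    · subst h1
      by_cases h2 : x = z <;> simp [h2] <;> ring
    · by_cases h2 : y = z
      · subst h2
        simp [h1]; ring
      · by_cases h3 : x = z <;> simp [h1, h2, h3] <;> grind
  have e : ∀ x y : ZMod d, (x = y ∧ y = x) ↔ x = y := by
    intro x y; tauto
  have e2 : ∀ x y z : ZMod d, (x = y ∧ y = z ∧ z = x) ↔ x = y ∧ y = z := by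
    intro x y z
    constructor
    · tauto
    · rintro ⟨rfl, rfl⟩; tauto
  have e3 : ∀ x y z : ZMod d, (x = z ∧ y = x ∧ z = y) ↔ x = y ∧ y = z := by
    intro x y z
    constructor
    · rintro ⟨rfl, rfl, _⟩; tauto
    · rintro ⟨rfl, rfl⟩; tauto
  rcases perm_fin_three σ with rfl | rfl | rfl | rfl | rfl | rfl
  · rw [if_pos rfl]
    simp only [Equiv.Perm.coe_one, id_eq, vec_three_values, and_true, if_true, hf,
      Finset.sum_add_distrib, Finset.sum_sub_distrib, ← Finset.mul_sum]
    simp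
    ring
  · rw [if_neg (by decide), if_neg (by decide)]
    simp only [swap_zero_one_values, vec_three_values, and_true, e, hf]
    have : ∀ x y z : ZMod d, (if x = y then 2 - ((d : ℂ) + 1) * (if x = y then 1 else 0) -
        (d + 1) * (if y = z then 1 else 0) - (d + 1) * (if x = z then 1 else 0) +
        (d ^ 2 + 3 * d + 2) * (if x = y then if y = z then 1 else 0 else 0) else 0) =
        if x = y then (1 - (d : ℂ)) + (d ^ 2 + d) * (if x = z then 1 else 0) else 0 := by
      intro x y z
      by_cases h : x = y
      · subst h; simp; split_ifs <;> ring
      · simp [h]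
    simp only [this]
    simp [Finset.sum_add_distrib, Finset.sum_ite_irrel]
    ring
  · rw [if_neg (by decide), if_neg (by decide)]
    simp only [swap_zero_two_values, vec_three_values, true_and, e, hf]
    have : ∀ x y z : ZMod d, (if x = z then 2 - ((d : ℂ) + 1) * (if x = y then 1 else 0) -
        (d + 1) * (if y = z then 1 else 0) - (d + 1) * (if x = z then 1 else 0) +
        (d ^ 2 + 3 * d + 2) * (if x = y then if y = z then 1 else 0 else 0) else 0) =
        if x = z then (1 - (d : ℂ)) + (d ^ 2 + d) * (if x = y then 1 else 0) else 0 := by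
      intro x y z
      by_cases h : x = z
      · subst h; by_cases h2 : x = y
        · subst h2; simp; ring
        · simp [h2, Ne.symm h2]; ring
      · simp [h]
    simp only [this]
    simp [Finset.sum_add_distrib]
    ring
  · rw [if_neg (by decide), if_neg (by decide)]
    simp only [swap_one_two_values, vec_three_values, true_and, e, hf]
    have : ∀ x y z : ZMod d, (if y = z then 2 - ((d : ℂ) + 1) * (if x = y then 1 else 0) -
        (d + 1) * (if y = z then 1 else 0) - (d + 1) * (if x = z then 1 else 0) +
        (d ^ 2 + 3 * d + 2) * (if x = y then if y = z then 1 else 0 else 0) else 0) =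
        if y = z then (1 - (d : ℂ)) + (d ^ 2 + d) * (if x = y then 1 else 0) else 0 := by
      intro x y z
      by_cases h : y = z
      · subst h; by_cases h2 : x = y
        · subst h2; simp; ring
        · simp [h2]; ring
      · simp [h]
    simp only [this]
    simp [Finset.sum_add_distrib]
    ring
  · rw [if_neg (by decide), if_pos (by decide)]
    simp only [finRotate_three_values, vec_three_values, e2, hf, ite_and]
    simp
    ring
  · rw [if_neg (by decide), if_pos (by decide)]
    simp only [finRotate_three_inv_values, vec_three_values, e3, hf, ite_and]
    simp
    ring

end Weight

/-! ### Symmetries and moments of the coefficients of `O_{--}` -/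

section Coefficients

variable {d : ℕ}

/-- `theta` is the determinant with rows `(1,1,1)`, `u`, `v`, hence alternating in the three copies.
-/
theorem theta_comp_perm (p : Fin 3 → ZMod d × ZMod d) (π : Equiv.Perm (Fin 3)) :
    theta (p ∘ π) = theta p ∨ theta (p ∘ π) = -theta p := by
  rcases perm_fin_three π with rfl | rfl | rfl | rfl | rfl | rfl
  · left; simp
  · right
    simp only [theta, Function.comp_apply, swap_zero_one_values]
    ring
  · right
    simp only [theta, Function.comp_apply, swap_zero_two_values]
    ring
  · right
    simp only [theta, Function.comp_apply, swap_one_two_values]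
    ring
  · left
    simp only [theta, Function.comp_apply, finRotate_three_values]
    ring
  · left
    simp only [theta, Function.comp_apply, finRotate_three_inv_values]
    ring

theorem theta_comp_swap (p : Fin 3 → ZMod d × ZMod d) :
    theta (p ∘ Equiv.swap 0 1) = -theta p := by
  simp only [theta, Function.comp_apply, swap_zero_one_values]
  ring

theorem theta_eq_zero_of_wt_ne_one (p : Fin 3 → ZMod d × ZMod d) (h : wt p ≠ 1) :
    theta p = 0 := by
  rw [wt_eq] at h
  have h' : p 0 = p 1 ∨ p 1 = p 2 ∨ p 0 = p 2 := by
    by_contra hn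
    rw [if_neg (fun h2 => hn (Or.inl h2.1)), if_neg hn] at h
    exact h rfl
  rcases h' with h' | h' | h' <;> simp only [theta, h'] <;> ring

theorem neg_mem_halfAngles {t : ZMod d} (ht : t ∈ halfAngles d) : -t ∈ halfAngles d := by
  have hcast : ∀ a b : ℕ, a + b = d → -(a : ZMod d) = b := by
    intro a b hab
    rw [neg_eq_iff_add_eq_zero, ← Nat.cast_add, hab, ZMod.natCast_self]
  unfold halfAngles at *
  split_ifs at * with h
  · rw [Finset.mem_singleton] at *
    rw [ht]
    refine hcast _ _ ?_
    obtain ⟨k, hk⟩ := h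
    omega
  · rw [Nat.not_even_iff_odd] at h
    obtain ⟨k, hk⟩ := h
    rw [Finset.mem_insert, Finset.mem_singleton] at *
    rcases ht with rfl | rfl
    · right; exact hcast _ _ (by omega)
    · left; exact hcast _ _ (by omega)

theorem neg_mem_halfAngles_iff {t : ZMod d} : -t ∈ halfAngles d ↔ t ∈ halfAngles d :=
  ⟨fun h => by simpa using neg_mem_halfAngles h, neg_mem_halfAngles⟩

theorem natCast_ne_zero_of_lt {a : ℕ} (h0 : 0 < a) (h : a < d) : (a : ZMod d) ≠ 0 := by
  rw [Ne, ZMod.natCast_eq_zero_iff]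
  exact Nat.not_dvd_of_pos_of_lt h0 h

theorem zero_notMem_halfAngles (hd : 2 ≤ d) : (0 : ZMod d) ∉ halfAngles d := by
  unfold halfAngles
  split_ifs with h
  · rw [Finset.mem_singleton]
    exact (natCast_ne_zero_of_lt (by omega) (by omega)).symm
  · rw [Nat.not_even_iff_odd] at h
    obtain ⟨k, hk⟩ := h
    rw [Finset.mem_insert, Finset.mem_singleton, not_or]
    exact ⟨(natCast_ne_zero_of_lt (by omega) (by omega)).symm,
      (natCast_ne_zero_of_lt (by omega) (by omega)).symm⟩

theorem wt_cases {α : Type*} [DecidableEq α] (p : Fin 3 → α) : wt p = 3 ∨ wt p = 2 ∨ wt p = 1 := by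
  rw [wt_eq]
  split_ifs <;> simp

theorem one_ne_zero_zmod (hd : 2 ≤ d) : (1 : ZMod d) ≠ 0 := by
  have := natCast_ne_zero_of_lt (d := d) (a := 1) one_pos (by omega)
  simpa using this

theorem halfAngles_nonempty : (halfAngles d).Nonempty := by
  unfold halfAngles
  split_ifs <;> simp

/-- For `d = 2`, three distinct points of the plane are never collinear, so the class of angle `0`
is empty. Its total must vanish for the division by its size to be harmless. -/
theorem Q1zero_two : Q1zero 2 = 0 := by
  rw [Q1zero, if_pos even_two]
  norm_num

theorem one_add_cos_pi_div_pos (hd : 2 ≤ d) : 0 < 1 + Real.cos (Real.pi / d) := by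
  have h2 : (2 : ℝ) ≤ d := by exact_mod_cast hd
  have hnn : 0 ≤ Real.cos (Real.pi / d) := by
    apply Real.cos_nonneg_of_neg_pi_div_two_le_of_le
    · have : 0 ≤ Real.pi / d := by positivity
      linarith [Real.pi_pos]
    · exact div_le_div_of_nonneg_left Real.pi_pos.le two_pos h2
  linarith

/-- The half-angle formula gives `Q1half` the same denominator as `Q1zero`. -/
theorem Q1half_odd (hodd : ¬Even d) :
    Q1half d = Q3 d * ((d : ℝ) ^ 2 / (1 + Real.cos (Real.pi / d))) := by
  rw [Q1half, if_neg hodd]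
  have h := Real.cos_sq (Real.pi / (2 * d))
  rw [show 2 * (Real.pi / (2 * (d : ℝ))) = Real.pi / d by field_simp] at h
  rw [h]
  congr 2
  ring

variable [NeZero d]

theorem coeffMM_comp_perm (p : Fin 3 → ZMod d × ZMod d) (π : Equiv.Perm (Fin 3)) :
    coeffMM d (p ∘ π) = coeffMM d p := by
  simp only [coeffMM, wt_comp_perm]
  rcases theta_comp_perm p π with h | h <;> rw [h]
  simp only [neg_eq_zero, neg_mem_halfAngles_iff]

theorem nWt_three_ne_zero : nWt d 3 ≠ 0 := by
  refine Finset.card_ne_zero_of_mem (a := fun _ => (0, 0)) ?_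
  simp [wt_eq]

theorem nWt_two_ne_zero (hd : 2 ≤ d) : nWt d 2 ≠ 0 := by
  refine Finset.card_ne_zero_of_mem (a := ![(0, 0), (0, 0), (1, 0)]) ?_
  have h := one_ne_zero_zmod hd
  simp [wt_eq, h.symm]

theorem nAngle_ne_zero (hd : 2 ≤ d) {S : Finset (ZMod d)} {t : ZMod d} (ht : t ∈ S) (h0 : t ≠ 0) :
    nAngle d S ≠ 0 := by
  -- A triangle of determinant exactly `t`.
  refine Finset.card_ne_zero_of_mem (a := ![(0, 0), (1, 0), (0, t)]) ?_
  have h := one_ne_zero_zmod hd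
  simp [wt_eq, theta, h, h.symm, h0.symm, ht]

theorem nAngle_zero_ne_zero (hd : 3 ≤ d) : nAngle d {0} ≠ 0 := by
  refine Finset.card_ne_zero_of_mem (a := ![(0, 0), (1, 0), (2, 0)]) ?_
  have h := one_ne_zero_zmod (d := d) (by omega)
  have h2 : (2 : ZMod d) ≠ 0 := by
    simpa using natCast_ne_zero_of_lt (d := d) (a := 2) two_pos (by omega)
  have h3 : (1 : ZMod d) ≠ 2 := by
    intro h3
    apply h
    linear_combination -h3
  simp [wt_eq, theta, h.symm, h2.symm, h3]

theorem nAngle_half_ne_zero (hd : 2 ≤ d) : nAngle d (halfAngles d) ≠ 0 := by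
  obtain ⟨t, ht⟩ := halfAngles_nonempty (d := d)
  exact nAngle_ne_zero hd ht fun h => zero_notMem_halfAngles hd (h ▸ ht)

/-- Sums of the coefficients against a function constant on each class of triples. -/
theorem sum_coeffMM_mul (hd : 2 ≤ d) (g : (Fin 3 → ZMod d × ZMod d) → ℝ) (a3 a2 a0 aH : ℝ)
    (h3 : ∀ p, wt p = 3 → g p = a3) (h2 : ∀ p, wt p = 2 → g p = a2)
    (h0 : ∀ p, wt p = 1 → theta p = 0 → g p = a0)
    (hH : ∀ p, wt p = 1 → theta p ∈ halfAngles d → g p = aH) :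
    ∑ p, coeffMM d p * g p = Q3 d * a3 + Q2 d * a2 + Q1zero d * a0 + Q1half d * aH := by
  have hz := zero_notMem_halfAngles hd
  have key : ∀ p, coeffMM d p * g p =
      (if wt p = 3 then Q3 d / nWt d 3 * a3 else 0) + (if wt p = 2 then Q2 d / nWt d 2 * a2 else 0) +
      (if wt p = 1 ∧ theta p ∈ ({0} : Finset (ZMod d)) then Q1zero d / nAngle d {0} * a0 else 0) +
      (if wt p = 1 ∧ theta p ∈ halfAngles d then
        Q1half d / nAngle d (halfAngles d) * aH else 0) := by
    intro p
    simp only [Finset.mem_singleton]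
    rcases wt_cases p with h | h | h
    · simp [coeffMM, h, h3 p h]
    · simp [coeffMM, h, h2 p h]
    · by_cases ht : theta p = 0
      · simp [coeffMM, h, h0 p h ht, ht, hz]
      · by_cases ht' : theta p ∈ halfAngles d
        · simp [coeffMM, h, hH p h ht', ht, ht']
        · simp [coeffMM, h, ht, ht']
  have hsum : ∀ (P : (Fin 3 → ZMod d × ZMod d) → Prop) [DecidablePred P] (c : ℝ),
      ∑ p, (if P p then c else 0) = ((Finset.univ.filter P).card : ℝ) * c := by
    intro P _ c
    rw [← Finset.sum_filter, Finset.sum_const, nsmul_eq_mul]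
  simp only [key, Finset.sum_add_distrib, hsum]
  have e : ∀ (n : ℕ) (Q a : ℝ), n ≠ 0 → (n : ℝ) * (Q / n * a) = Q * a := by
    intro n Q a hn
    have : (n : ℝ) ≠ 0 := by exact_mod_cast hn
    field_simp
  change (nWt d 3 : ℝ) * _ + (nWt d 2 : ℝ) * _ + (nAngle d {0} : ℝ) * _ +
    (nAngle d (halfAngles d) : ℝ) * _ = _
  rw [e _ _ _ nWt_three_ne_zero, e _ _ _ (nWt_two_ne_zero hd), e _ _ _ (nAngle_half_ne_zero hd)]
  congr 2
  -- At `d = 2` the angle-`0` term is zero on both sides; for `d ≥ 3` its class contains three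
  -- collinear points.
  rcases hd.eq_or_lt with h | h
  · subst h; simp [Q1zero_two]
  · rw [e _ _ _ (nAngle_zero_ne_zero h)]

/-- `cos (2π t / d)` on the angles nearest to `d / 2`. -/
theorem stdAddChar_re_halfAngles {t : ZMod d} (ht : t ∈ halfAngles d) :
    (ZMod.stdAddChar t).re = if Even d then -1 else -Real.cos (Real.pi / d) := by
  have hd0 : (d : ℝ) ≠ 0 := by exact_mod_cast NeZero.ne d
  have hre : ∀ n : ℕ, (ZMod.stdAddChar (n : ZMod d)).re = Real.cos (2 * Real.pi * n / d) := by
    intro n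
    have h := ZMod.stdAddChar_coe (N := d) (n : ℤ)
    rw [Int.cast_natCast] at h
    rw [h, show (2 * (Real.pi : ℂ) * Complex.I * ((n : ℤ) : ℂ) / (d : ℂ)) =
      ((2 * Real.pi * n / d : ℝ) : ℂ) * Complex.I by push_cast; ring, Complex.exp_ofReal_mul_I_re]
  unfold halfAngles at ht
  split_ifs at ht ⊢ with h
  · obtain ⟨k, hk⟩ := h
    rw [Finset.mem_singleton.mp ht, hre, show d / 2 = k by omega]
    rw [show 2 * Real.pi * k / d = Real.pi by
      rw [div_eq_iff hd0, hk]; push_cast; ring, Real.cos_pi]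
  · rw [Nat.not_even_iff_odd] at h
    obtain ⟨k, hk⟩ := h
    have hdk : (d : ℝ) = 2 * k + 1 := by rw [hk]; push_cast; ring
    rw [Finset.mem_insert, Finset.mem_singleton] at ht
    rcases ht with rfl | rfl
    · rw [hre, show (d - 1) / 2 = k by omega, ← Real.cos_pi_sub]
      congr 1
      field_simp
      rw [hdk]; ring
    · rw [hre, show (d + 1) / 2 = k + 1 by omega, ← Real.cos_add_pi]
      congr 1
      field_simp
      push_cast
      rw [hdk]; ring

theorem sum_coeffMM (hd : 2 ≤ d) : ∑ p, coeffMM d p = 0 := by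
  have h := sum_coeffMM_mul hd (fun _ => 1) 1 1 1 1 (fun _ _ => rfl) (fun _ _ => rfl)
    (fun _ _ _ => rfl) (fun _ _ _ => rfl)
  simp only [mul_one] at h
  rw [h]
  by_cases he : Even d
  · rw [Q1zero, Q1half, if_pos he, if_pos he, Q2]; ring
  · rw [Q1half_odd he, Q1zero, if_neg he, Q2]
    have := (one_add_cos_pi_div_pos hd).ne'
    field_simp
    ring

theorem sum_comp_perm {M : Type*} [AddCommMonoid M] (π : Equiv.Perm (Fin 3))
    (F : (Fin 3 → ZMod d × ZMod d) → M) : ∑ p, F (p ∘ π) = ∑ p, F p :=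
  (Equiv.arrowCongr π.symm (Equiv.refl (ZMod d × ZMod d))).sum_comp F

/-- By symmetry the three pairs of copies give equal sums. Together they count 3 in weight 3 and 1
in weight 2, giving `3Q₃ + Q₂ = 0`. -/
theorem sum_coeffMM_of_eq (hd : 2 ≤ d) :
    ∑ p, coeffMM d p * (if p 0 = p 1 then 1 else 0) = 0 := by
  have h1 : ∑ p, coeffMM d p * (if p 1 = p 2 then 1 else 0) =
      ∑ p, coeffMM d p * (if p 0 = p 1 then 1 else 0) := by
    rw [← sum_comp_perm (finRotate 3) fun p => coeffMM d p * (if p 0 = p 1 then 1 else 0)]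
    simp only [coeffMM_comp_perm, Function.comp_apply, finRotate_three_values]
  have h2 : ∑ p, coeffMM d p * (if p 0 = p 2 then 1 else 0) =
      ∑ p, coeffMM d p * (if p 0 = p 1 then 1 else 0) := by
    rw [← sum_comp_perm (Equiv.swap 1 2) fun p => coeffMM d p * (if p 0 = p 1 then 1 else 0)]
    simp only [coeffMM_comp_perm, Function.comp_apply, swap_one_two_values]
  have h := sum_coeffMM_mul hd (fun p => (if p 0 = p 1 then 1 else 0) +
    (if p 1 = p 2 then 1 else 0) + (if p 0 = p 2 then 1 else 0)) 3 1 0 0 ?_ ?_ ?_ ?_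
  · simp only [mul_add, Finset.sum_add_distrib, h1, h2] at h
    rw [Q2] at h
    linarith
  all_goals
    intro p
    rw [wt_eq]
    by_cases e1 : p 0 = p 1 <;> by_cases e2 : p 1 = p 2 <;> by_cases e3 : p 0 = p 2 <;>
      simp_all <;> norm_num

theorem sum_coeffMM_of_eq_eq (hd : 2 ≤ d) :
    ∑ p, coeffMM d p * (if p 0 = p 1 ∧ p 1 = p 2 then 1 else 0) = Q3 d := by
  rw [sum_coeffMM_mul hd _ 1 0 0 0]
  · ring
  all_goals
    intro p
    rw [wt_eq]
    by_cases e1 : p 0 = p 1 <;> by_cases e2 : p 1 = p 2 <;> by_cases e3 : p 0 = p 2 <;>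
      simp_all

/-- Swapping two copies preserves the coefficients and negates `theta`, so only the cosine survives;
it takes a single value on `halfAngles`. -/
theorem sum_coeffMM_theta (hd : 2 ≤ d) :
    ∑ p, (coeffMM d p : ℂ) * ZMod.stdAddChar (-theta p) = -((d : ℂ) ^ 2 * Q3 d) := by
  have hneg : ∑ p, (coeffMM d p : ℂ) * ZMod.stdAddChar (-theta p) =
      ∑ p, (coeffMM d p : ℂ) * ZMod.stdAddChar (theta p) := by
    rw [← sum_comp_perm (Equiv.swap 0 1) fun p => (coeffMM d p : ℂ) * ZMod.stdAddChar (theta p)]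
    simp only [coeffMM_comp_perm, theta_comp_swap]
  have hre : ∀ t : ZMod d, ZMod.stdAddChar t + ZMod.stdAddChar (-t) =
      2 * (((ZMod.stdAddChar t).re : ℝ) : ℂ) := by
    intro t
    rw [AddChar.map_neg_eq_conj, Complex.add_conj]
    push_cast; rfl
  have h2 : ∑ p, (coeffMM d p : ℂ) * ZMod.stdAddChar (-theta p) =
      ((∑ p, coeffMM d p * (ZMod.stdAddChar (theta p)).re : ℝ) : ℂ) := by
    have : 2 * ∑ p, (coeffMM d p : ℂ) * ZMod.stdAddChar (-theta p) =
        2 * ((∑ p, coeffMM d p * (ZMod.stdAddChar (theta p)).re : ℝ) : ℂ) := by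
      conv_lhs => rw [two_mul]
      nth_rewrite 1 [hneg]
      rw [← Finset.sum_add_distrib, Complex.ofReal_sum, Finset.mul_sum]
      refine Finset.sum_congr rfl fun p _ => ?_
      rw [← mul_add, hre]
      push_cast
      ring
    exact mul_left_cancel₀ two_ne_zero this
  rw [h2]
  have h3 := sum_coeffMM_mul hd (fun p => (ZMod.stdAddChar (theta p)).re) 1 1 1
    (if Even d then -1 else -Real.cos (Real.pi / d))
    (fun p hp => by simp [theta_eq_zero_of_wt_ne_one p (by omega)])
    (fun p hp => by simp [theta_eq_zero_of_wt_ne_one p (by omega)])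
    (fun p _ hp => by simp [hp]) (fun p _ hp => stdAddChar_re_halfAngles hp)
  rw [h3, ← Complex.ofReal_natCast, ← Complex.ofReal_pow, ← Complex.ofReal_mul,
    ← Complex.ofReal_neg]
  congr 1
  by_cases he : Even d
  · rw [Q1zero, Q1half, if_pos he, if_pos he, if_pos he, Q2]; ring
  · rw [Q1half_odd he, Q1zero, if_neg he, if_neg he, Q2]
    have := (one_add_cos_pi_div_pos hd).ne'
    field_simp
    ring

end Coefficients

/-! ### Character sums for overlaps with Bell projectors -/

section Bell

variable {d : ℕ} [NeZero d]

theorem bellProj_apply (u v : ZMod d) (a b : ZMod d × ZMod d) : bellProj d u v a b =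
    if a.2 = a.1 + u then if b.2 = b.1 + u then
      (d : ℂ)⁻¹ * ZMod.stdAddChar ((a.1 - b.1) * v) else 0 else 0 := by
  have hs : ((Real.sqrt d : ℝ) : ℂ)⁻¹ * ((Real.sqrt d : ℝ) : ℂ)⁻¹ = (d : ℂ)⁻¹ := by
    rw [← mul_inv, ← Complex.ofReal_mul, Real.mul_self_sqrt (Nat.cast_nonneg d),
      Complex.ofReal_natCast]
  simp only [bellProj, Matrix.vecMulVec_apply, Pi.star_apply, bellVec]
  split_ifs with h1 h2
  · rw [sub_mul, sub_eq_add_neg, AddChar.map_add_eq_mul, AddChar.map_neg_eq_conj, ← hs, star_mul',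
      star_inv₀, show star ((Real.sqrt d : ℝ) : ℂ) = _ from Complex.conj_ofReal _]
    change _ = _ * (_ * star _)
    ring
  all_goals simp

theorem isHermitian_bellProj (u v : ZMod d) : (bellProj d u v).IsHermitian := by
  rw [Matrix.IsHermitian, bellProj, Matrix.conjTranspose_vecMulVec, star_star]

theorem isHermitian_OMM : (OMM d).IsHermitian := by
  have h : ∀ p : Fin 3 → ZMod d × ZMod d,
      (copyTensor fun i => bellProj d (p i).1 (p i).2).conjTranspose =
        copyTensor fun i => bellProj d (p i).1 (p i).2 := by
    intro p
    ext x y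
    simp only [Matrix.conjTranspose_apply, copyTensor, Matrix.of_apply, star_prod]
    exact Finset.prod_congr rfl fun i _ => (isHermitian_bellProj _ _).apply _ _
  rw [Matrix.IsHermitian, OMM, bellDiagonal, Matrix.conjTranspose_sum]
  refine Finset.sum_congr rfl fun p _ => ?_
  rw [Matrix.conjTranspose_smul, h]
  congr 1
  exact Complex.conj_ofReal _

theorem trace_permOp_kronecker_mul (σ τ : Equiv.Perm (Fin 3)) (X : Matrix (Idx d) (Idx d) ℂ) :
    ((permOp d σ ⊗ₖ permOp d τ) * X).trace = ∑ y : Idx d, X y (y.1 ∘ σ, y.2 ∘ τ) := by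
  rw [Matrix.trace_mul_comm, Matrix.trace]
  refine Finset.sum_congr rfl fun y _ => ?_
  rw [Matrix.diag_apply, Matrix.mul_apply, Finset.sum_eq_single (y.1 ∘ σ, y.2 ∘ τ)]
  · simp [permOp, Matrix.kroneckerMap_apply]
  · rintro ⟨x1, x2⟩ _ hx
    simp only [permOp, Matrix.kroneckerMap_apply, Matrix.of_apply]
    rw [ne_eq, Prod.mk.injEq, not_and_or] at hx
    rcases hx with hx | hx <;> simp [hx]
  · simp

/-- The overlap of `W_σ ⊗ W_τ` with a product of Bell projectors, up to the factor `d^3`. -/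
noncomputable def bellSum (d : ℕ) [NeZero d] (σ τ : Equiv.Perm (Fin 3))
    (p : Fin 3 → ZMod d × ZMod d) : ℂ :=
  ∑ y : Fin 3 → ZMod d, ∏ i, if y (τ i) + (p (τ i)).1 = y (σ i) + (p i).1 then
    ZMod.stdAddChar ((y i - y (σ i)) * (p i).2) else 0

theorem trace_permOp_mul_bellProj (σ τ : Equiv.Perm (Fin 3)) (p : Fin 3 → ZMod d × ZMod d) :
    ((permOp d σ ⊗ₖ permOp d τ) * copyTensor fun i => bellProj d (p i).1 (p i).2).trace =
      ((d : ℂ)⁻¹) ^ 3 * bellSum d σ τ p := by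
  rw [trace_permOp_kronecker_mul, Fintype.sum_prod_type, bellSum, Finset.mul_sum]
  refine Finset.sum_congr rfl fun y _ => ?_
  -- The support of each Bell vector fixes the `B` index as the `A` index plus `u`.
  rw [Finset.sum_eq_single fun i => y i + (p i).1]
  · have h3 : ((d : ℂ)⁻¹) ^ 3 = ∏ _i : Fin 3, (d : ℂ)⁻¹ := by simp
    rw [h3, ← Finset.prod_mul_distrib, copyTensor, Matrix.of_apply]
    refine Finset.prod_congr rfl fun i _ => ?_
    rw [bellProj_apply]
    simp [mul_ite]
  · intro z _ hz
    obtain ⟨i, hi⟩ := Function.ne_iff.mp hz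
    rw [copyTensor, Matrix.of_apply]
    refine Finset.prod_eq_zero (Finset.mem_univ i) ?_
    rw [bellProj_apply, if_neg hi]
  · simp

/-- Relabel the copies in both the summation variable and the product. -/
theorem bellSum_conj (σ τ π : Equiv.Perm (Fin 3)) (p : Fin 3 → ZMod d × ZMod d) :
    bellSum d (π * σ * π⁻¹) (π * τ * π⁻¹) p = bellSum d σ τ (p ∘ π) := by
  rw [bellSum, bellSum, ← (Equiv.arrowCongr π (Equiv.refl (ZMod d))).sum_comp]
  refine Finset.sum_congr rfl fun y _ => ?_
  rw [← Equiv.prod_comp π]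
  refine Finset.prod_congr rfl fun i _ => ?_
  simp

/-- With `σ = 1` all phases are trivial, and the shift `y ↦ y + u` removes the labels from the
constraints. -/
theorem bellSum_one_left (τ : Equiv.Perm (Fin 3)) (p : Fin 3 → ZMod d × ZMod d) :
    bellSum d 1 τ p = bellSum d 1 τ 0 := by
  refine Fintype.sum_equiv (Equiv.addRight fun i => (p i).1) _ _ fun y => ?_
  simp

/-- With `τ = 1` the constraints become `y i = y (σ i)`, which trivializes the phases. -/
theorem bellSum_one_right (σ : Equiv.Perm (Fin 3)) (p : Fin 3 → ZMod d × ZMod d) :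
    bellSum d σ 1 p = bellSum d σ 1 0 := by
  rw [bellSum, bellSum]
  refine Finset.sum_congr rfl fun y _ => Finset.prod_congr rfl fun i _ => ?_
  by_cases h : y i = y (σ i) <;> simp [h]

theorem bellSum_eq_sum (σ τ : Equiv.Perm (Fin 3)) (p : Fin 3 → ZMod d × ZMod d) :
    bellSum d σ τ p = ∑ x, ∑ y, ∑ z,
      if (![x, y, z] (τ 0) + (p (τ 0)).1 = ![x, y, z] (σ 0) + (p 0).1 ∧
        ![x, y, z] (τ 1) + (p (τ 1)).1 = ![x, y, z] (σ 1) + (p 1).1) ∧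
        ![x, y, z] (τ 2) + (p (τ 2)).1 = ![x, y, z] (σ 2) + (p 2).1 then
        ZMod.stdAddChar ((x - ![x, y, z] (σ 0)) * (p 0).2 + (y - ![x, y, z] (σ 1)) * (p 1).2 +
          (z - ![x, y, z] (σ 2)) * (p 2).2) else (0 : ℂ) := by
  rw [bellSum, sum_fin_three_fun]
  refine Finset.sum_congr rfl fun x _ => Finset.sum_congr rfl fun y _ =>
    Finset.sum_congr rfl fun z _ => ?_
  rw [Fin.prod_univ_three, AddChar.map_add_eq_mul, AddChar.map_add_eq_mul]
  simp only [vec_three_values, ite_and, mul_ite, mul_zero, ite_mul, zero_mul]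
  split_ifs <;> rfl

/-- The constraints force `x = y`, which kills the phase, and determine `z`. -/
theorem bellSum_swap_swap (p : Fin 3 → ZMod d × ZMod d) :
    bellSum d (Equiv.swap 0 1) (Equiv.swap 0 2) p = d := by
  rw [bellSum_eq_sum]
  simp only [swap_zero_one_values, swap_zero_two_values, vec_three_values]
  have e : ∀ x y z : ZMod d, (if (z + (p 2).1 = y + (p 0).1 ∧ y + (p 1).1 = x + (p 1).1) ∧
      x + (p 0).1 = z + (p 2).1 then (ZMod.stdAddChar ((x - y) * (p 0).2 + (y - x) * (p 1).2 +
        (z - z) * (p 2).2) : ℂ) else 0) =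
      if x = y then if z = x + (p 0).1 - (p 2).1 then 1 else 0 else 0 := by
    intro x y z
    rw [← ite_and]
    by_cases h : x = y
    · subst h
      simp only [sub_self, zero_mul, add_zero, AddChar.map_zero_eq_one, true_and, and_true]
      congr 1
      rw [eq_iff_iff]
      constructor
      · rintro ⟨h, _⟩; linear_combination h
      · intro h
        exact ⟨by linear_combination h, by linear_combination -h⟩
    · rw [if_neg fun h' => h (add_right_cancel h'.1.2).symm, if_neg fun h' => h h'.1]
  simp only [e]
  simp [Finset.sum_ite_irrel]

/-- Orthogonality of characters over pairs. -/
theorem sum_sum_stdAddChar_sub_mul (w : ZMod d) :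
    ∑ x : ZMod d, ∑ y : ZMod d, (ZMod.stdAddChar ((x - y) * w) : ℂ) =
      if w = 0 then (d : ℂ) ^ 2 else 0 := by
  have h := AddChar.sum_mulShift (R' := ℂ) w (ZMod.isPrimitive_stdAddChar d)
  rw [Finset.sum_comm]
  have h2 : ∀ y : ZMod d, ∑ x : ZMod d, (ZMod.stdAddChar ((x - y) * w) : ℂ) =
      ∑ x : ZMod d, (ZMod.stdAddChar (x * w) : ℂ) := fun y =>
    (Equiv.subRight y).sum_comp fun x => (ZMod.stdAddChar (x * w) : ℂ)
  simp only [h2, h]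
  split_ifs <;> simp [sq]

/-- The constraints compare only the labels `u`, character orthogonality compares the labels `v`,
and `z` stays free. -/
theorem bellSum_swap_self (p : Fin 3 → ZMod d × ZMod d) :
    bellSum d (Equiv.swap 0 1) (Equiv.swap 0 1) p =
      (d : ℂ) ^ 3 * if p 0 = p 1 then 1 else 0 := by
  rw [bellSum_eq_sum]
  simp only [swap_zero_one_values, vec_three_values, add_right_inj]
  by_cases hu : (p 0).1 = (p 1).1
  · have e : ∀ x y z : ZMod d, (x - y) * (p 0).2 + (y - x) * (p 1).2 + (z - z) * (p 2).2 =
        (x - y) * ((p 0).2 - (p 1).2) := by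
      intro x y z; ring
    simp only [hu, e, and_self, if_true, Finset.sum_const, ← Finset.smul_sum,
      sum_sum_stdAddChar_sub_mul, sub_eq_zero, Prod.ext_iff, true_and]
    split_ifs <;> simp
    ring
  · have hne : p 0 ≠ p 1 := fun h => hu (by rw [h])
    simp [hu, hne, Ne.symm hu]

theorem bellSum_swap_finRotate (p : Fin 3 → ZMod d × ZMod d) :
    bellSum d (Equiv.swap 0 1) (finRotate 3) p = (d : ℂ) ^ 2 * if p 0 = p 1 then 1 else 0 := by
  rw [bellSum_eq_sum]
  simp only [swap_zero_one_values, finRotate_three_values, vec_three_values, add_right_inj]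
  by_cases hu : (p 0).1 = (p 1).1
  · have e : ∀ x y z : ZMod d, (if ((p 1).1 = (p 0).1 ∧ z + (p 2).1 = x + (p 1).1) ∧
        x + (p 0).1 = z + (p 2).1 then (ZMod.stdAddChar ((x - y) * (p 0).2 + (y - x) * (p 1).2 +
          (z - z) * (p 2).2) : ℂ) else 0) =
        if z = x + (p 0).1 - (p 2).1 then
          (ZMod.stdAddChar ((x - y) * ((p 0).2 - (p 1).2)) : ℂ) else 0 := by
      intro x y z
      congr 1
      · rw [eq_iff_iff]
        constructor
        · rintro ⟨_, h⟩; linear_combination -h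
        · intro h
          exact ⟨⟨hu.symm, by linear_combination h + hu⟩, by linear_combination -h⟩
      · congr 1; ring
    simp only [e]
    simp only [Finset.sum_ite_eq', Finset.mem_univ, if_true, sum_sum_stdAddChar_sub_mul,
      sub_eq_zero, Prod.ext_iff, hu, true_and]
    split_ifs <;> simp
  · have hne : p 0 ≠ p 1 := fun h => hu (by rw [h])
    simp [hne, Ne.symm hu]

theorem bellSum_finRotate_swap (p : Fin 3 → ZMod d × ZMod d) :
    bellSum d (finRotate 3) (Equiv.swap 0 1) p = (d : ℂ) ^ 2 * if p 0 = p 1 then 1 else 0 := by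
  rw [bellSum_eq_sum]
  simp only [swap_zero_one_values, finRotate_three_values, vec_three_values, add_right_inj]
  by_cases hu : (p 0).1 = (p 1).1
  · have e : ∀ x y z : ZMod d, (if ((p 1).1 = (p 0).1 ∧ x + (p 0).1 = z + (p 1).1) ∧
        z + (p 2).1 = x + (p 2).1 then (ZMod.stdAddChar ((x - y) * (p 0).2 + (y - z) * (p 1).2 +
          (z - x) * (p 2).2) : ℂ) else 0) =
        if z = x then
          (ZMod.stdAddChar ((x - y) * ((p 0).2 - (p 1).2)) : ℂ) else 0 := by
      intro x y z
      by_cases h : z = x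
      · subst h
        rw [if_pos ⟨⟨hu.symm, by rw [hu]⟩, rfl⟩, if_pos rfl]
        congr 1; ring
      · rw [if_neg h, if_neg fun h' => h (add_right_cancel h'.2)]
    simp only [e]
    simp only [Finset.sum_ite_eq', Finset.mem_univ, if_true, sum_sum_stdAddChar_sub_mul,
      sub_eq_zero, Prod.ext_iff, hu, true_and]
    split_ifs <;> simp
  · have hne : p 0 ≠ p 1 := fun h => hu (by rw [h])
    simp [hne, Ne.symm hu]

theorem bellSum_finRotate_self (p : Fin 3 → ZMod d × ZMod d) :
    bellSum d (finRotate 3) (finRotate 3) p =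
      (d : ℂ) ^ 3 * if p 0 = p 1 ∧ p 1 = p 2 then 1 else 0 := by
  rw [bellSum_eq_sum]
  simp only [finRotate_three_values, vec_three_values, add_right_inj]
  by_cases hu : (p 0).1 = (p 1).1 ∧ (p 1).1 = (p 2).1
  · have e : ∀ x y z : ZMod d, (ZMod.stdAddChar ((x - y) * (p 0).2 + (y - z) * (p 1).2 +
        (z - x) * (p 2).2) : ℂ) = ZMod.stdAddChar (x * ((p 0).2 - (p 2).2)) *
          ZMod.stdAddChar (y * ((p 1).2 - (p 0).2)) *
          ZMod.stdAddChar (z * ((p 2).2 - (p 1).2)) := by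
      intro x y z
      rw [← AddChar.map_add_eq_mul, ← AddChar.map_add_eq_mul]
      congr 1; ring
    have hs := fun w : ZMod d =>
      AddChar.sum_mulShift (R' := ℂ) w (ZMod.isPrimitive_stdAddChar d)
    simp only [hu.1, hu.2, e, and_self, if_true, ← Finset.mul_sum, ← Finset.sum_mul, hs,
      sub_eq_zero, Prod.ext_iff, true_and]
    by_cases h1 : (p 0).2 = (p 1).2 <;> by_cases h2 : (p 1).2 = (p 2).2
    · simp [h1, h2]; ring
    · simp [h2, Ne.symm h2]
    · simp [h1, Ne.symm h1]
    · simp [h1, Ne.symm h1]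
  · have hne : ¬(p 0 = p 1 ∧ p 1 = p 2) := fun h => hu ⟨by rw [h.1], by rw [h.2]⟩
    have hne' : ¬(((p 1).1 = (p 0).1 ∧ (p 2).1 = (p 1).1) ∧ (p 0).1 = (p 2).1) :=
      fun h => hu ⟨h.1.1.symm, h.1.2.symm⟩
    simp [hne, hne']

/-- Two constraints determine `y` and `z` from `x`, and the third is redundant. On the solutions the
phase no longer depends on `x`, leaving the determinant `theta`. -/
theorem bellSum_finRotate_inv (p : Fin 3 → ZMod d × ZMod d) :
    bellSum d (finRotate 3) (finRotate 3)⁻¹ p = d * ZMod.stdAddChar (-theta p) := by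
  rw [bellSum_eq_sum]
  simp only [finRotate_three_values, finRotate_three_inv_values, vec_three_values]
  have e : ∀ x y z : ZMod d, (if (z + (p 2).1 = y + (p 0).1 ∧ x + (p 0).1 = z + (p 1).1) ∧
      y + (p 1).1 = x + (p 2).1 then (ZMod.stdAddChar ((x - y) * (p 0).2 + (y - z) * (p 1).2 +
        (z - x) * (p 2).2) : ℂ) else 0) =
      if y = x + (p 2).1 - (p 1).1 then if z = x + (p 0).1 - (p 1).1 then
        ZMod.stdAddChar (-theta p) else 0 else 0 := by
    intro x y z
    rw [← ite_and]
    by_cases h : y = x + (p 2).1 - (p 1).1 ∧ z = x + (p 0).1 - (p 1).1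
    · rw [if_pos h, if_pos]
      · congr 1
        rw [h.1, h.2, theta]
        ring
      · rw [h.1, h.2]
        refine ⟨⟨?_, ?_⟩, ?_⟩ <;> ring
    · rw [if_neg h, if_neg]
      intro h'
      exact h ⟨by linear_combination h'.2, by linear_combination -h'.1.2⟩
  simp only [e]
  simp

end Bell

/-! ### Regrouping copies, and Bell-measurement probabilities -/

section CopyTensor

variable {d : ℕ}

theorem tensorPow_kronecker_tensorPow (U V : Matrix (ZMod d) (ZMod d) ℂ) :
    tensorPow 3 U ⊗ₖ tensorPow 3 V = copyTensor fun _ => U ⊗ₖ V := by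
  ext x y
  simp only [tensorPow, copyTensor, Matrix.kroneckerMap_apply, Matrix.of_apply,
    Finset.prod_mul_distrib]

theorem conjTranspose_copyTensor (M : Fin 3 → Matrix (ZMod d × ZMod d) (ZMod d × ZMod d) ℂ) :
    (copyTensor M).conjTranspose = copyTensor fun i => (M i).conjTranspose := by
  ext x y
  simp only [copyTensor, Matrix.conjTranspose_apply, Matrix.of_apply, star_prod]

variable [NeZero d]

theorem sum_idx_eq (F : Idx d → ℂ) :
    ∑ x, F x = ∑ q : Fin 3 → ZMod d × ZMod d, F (fun i => (q i).1, fun i => (q i).2) :=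
  ((Equiv.arrowProdEquivProdArrow (Fin 3) (fun _ => ZMod d) (fun _ => ZMod d)).sum_comp F).symm

theorem copyTensor_mul (M N : Fin 3 → Matrix (ZMod d × ZMod d) (ZMod d × ZMod d) ℂ) :
    copyTensor M * copyTensor N = copyTensor fun i => M i * N i := by
  ext x y
  simp only [Matrix.mul_apply, copyTensor, Matrix.of_apply]
  rw [sum_idx_eq, Fintype.prod_sum]
  exact Finset.sum_congr rfl fun q _ => Finset.prod_mul_distrib.symm

theorem trace_copyTensor (M : Fin 3 → Matrix (ZMod d × ZMod d) (ZMod d × ZMod d) ℂ) :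
    (copyTensor M).trace = ∏ i, (M i).trace := by
  simp only [Matrix.trace, copyTensor, Matrix.diag_apply, Matrix.of_apply]
  rw [sum_idx_eq, Fintype.prod_sum]

/-- A product of traces is the trace of a tensor product, so the post-processed outcome statistics
are one observable evaluated on `ρ^{⊗3}`. -/
theorem sum_mul_prod_bellProb (O : (Fin 3 → ZMod d × ZMod d) → ℝ)
    (ρ : Matrix (ZMod d × ZMod d) (ZMod d × ZMod d) ℂ) (g : UGroup d × UGroup d) :
    ∑ p, (O p : ℂ) * ∏ i, bellProb ρ g.1 g.2 (p i) =
      (bellDiagonal O * ((tensorPow 3 (g.1 : Matrix (ZMod d) (ZMod d) ℂ) ⊗ₖ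
        tensorPow 3 (g.2 : Matrix (ZMod d) (ZMod d) ℂ)) * (copyTensor fun _ => ρ) *
      (tensorPow 3 (g.1 : Matrix (ZMod d) (ZMod d) ℂ) ⊗ₖ
        tensorPow 3 (g.2 : Matrix (ZMod d) (ZMod d) ℂ)).conjTranspose)).trace := by
  rw [tensorPow_kronecker_tensorPow, conjTranspose_copyTensor, copyTensor_mul, copyTensor_mul,
    bellDiagonal, Finset.sum_mul, Matrix.trace_sum]
  refine Finset.sum_congr rfl fun p _ => ?_
  rw [Matrix.smul_mul, Matrix.trace_smul, copyTensor_mul, trace_copyTensor, smul_eq_mul]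
  rfl

end CopyTensor

/-! ### Matching the traces, and conclusion -/

section Main

variable {d : ℕ} [NeZero d]

theorem trace_permOp_mul_OMM (σ τ : Equiv.Perm (Fin 3)) :
    ((permOp d σ ⊗ₖ permOp d τ) * OMM d).trace =
      ((d : ℂ)⁻¹) ^ 3 * ∑ p, (coeffMM d p : ℂ) * bellSum d σ τ p := by
  rw [OMM, bellDiagonal, Finset.mul_sum, Matrix.trace_sum, Finset.mul_sum]
  refine Finset.sum_congr rfl fun p _ => ?_
  rw [Matrix.mul_smul, Matrix.trace_smul, trace_permOp_mul_bellProj, smul_eq_mul]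
  ring

theorem sum_coeffMM_mul_bellSum_conj (σ τ π : Equiv.Perm (Fin 3)) :
    ∑ p, (coeffMM d p : ℂ) * bellSum d (π * σ * π⁻¹) (π * τ * π⁻¹) p =
      ∑ p, (coeffMM d p : ℂ) * bellSum d σ τ p := by
  rw [← sum_comp_perm π fun p => (coeffMM d p : ℂ) * bellSum d σ τ p]
  simp only [bellSum_conj, coeffMM_comp_perm]

theorem sum_coeffMM_mul_const (hd : 2 ≤ d) (c : ℂ) : ∑ p, (coeffMM d p : ℂ) * c = 0 := by
  rw [← Finset.sum_mul, ← Complex.ofReal_sum, sum_coeffMM hd, Complex.ofReal_zero, zero_mul]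

theorem sum_coeffMM_mul_ite (hd : 2 ≤ d) (c : ℂ) :
    ∑ p, (coeffMM d p : ℂ) * (c * if p 0 = p 1 then 1 else 0) = 0 := by
  have h := congrArg (fun r : ℝ => (r : ℂ) * c) (sum_coeffMM_of_eq hd)
  simp only [Complex.ofReal_zero, zero_mul, Complex.ofReal_sum, Finset.sum_mul] at h
  refine (Finset.sum_congr rfl fun p _ => ?_).trans h
  split_ifs <;> simp

/-- Up to simultaneous conjugation, the pairs of permutations of three letters for which the
coefficients of `O_{--}` sum to zero, and the four remaining pairs. -/
theorem perm_pair_cases (σ τ : Equiv.Perm (Fin 3)) :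
    (((σ = 1 ∨ τ = 1) ∨ ∃ π : Equiv.Perm (Fin 3), ∃ q ∈
      ({(Equiv.swap 0 1, Equiv.swap 0 1), (Equiv.swap 0 1, Equiv.swap 0 2),
        (Equiv.swap 0 1, finRotate 3), (finRotate 3, Equiv.swap 0 1)} :
        Finset (Equiv.Perm (Fin 3) × Equiv.Perm (Fin 3))),
        σ = π * q.1 * π⁻¹ ∧ τ = π * q.2 * π⁻¹) ∧
      ((σ ≠ finRotate 3 ∧ σ ≠ (finRotate 3)⁻¹) ∨ (τ ≠ finRotate 3 ∧ τ ≠ (finRotate 3)⁻¹))) ∨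
    (σ = finRotate 3 ∧ τ = finRotate 3) ∨ (σ = finRotate 3 ∧ τ = (finRotate 3)⁻¹) ∨
    (σ = (finRotate 3)⁻¹ ∧ τ = finRotate 3) ∨ (σ = (finRotate 3)⁻¹ ∧ τ = (finRotate 3)⁻¹) := by
  revert σ τ
  decide

/-- Both sides vanish unless `σ` and `τ` are 3-cycles. For these they equal `Q₃` when the cycles
agree and `-Q₃` when they are inverse. -/
theorem trace_permOp_mul_OMM_eq (hd : 2 ≤ d) (σ τ : Equiv.Perm (Fin 3)) :
    ((permOp d σ ⊗ₖ permOp d τ) * OMM d).trace =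
      ((permOp d σ ⊗ₖ permOp d τ) * (Mminus d ⊗ₖ Mminus d)).trace := by
  have hd0 : (d : ℂ) ≠ 0 := by exact_mod_cast NeZero.ne d
  rw [← Matrix.mul_kronecker_mul, Matrix.trace_kronecker, trace_permOp_mul_Mminus,
    trace_permOp_mul_Mminus, trace_permOp_mul_OMM]
  have hQ : ((Q3 d : ℝ) : ℂ) = ((d : ℂ) ^ 3 - d) ^ 2 := by
    rw [Q3]; push_cast; ring
  have hcc : ∑ p, (coeffMM d p : ℂ) * bellSum d (finRotate 3) (finRotate 3) p =
      (d : ℂ) ^ 3 * Q3 d := by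
    have h := congrArg (fun r : ℝ => (d : ℂ) ^ 3 * (r : ℂ)) (sum_coeffMM_of_eq_eq hd)
    simp only [Complex.ofReal_sum, Finset.mul_sum] at h
    rw [← h]
    refine Finset.sum_congr rfl fun p _ => ?_
    rw [bellSum_finRotate_self]
    split_ifs <;> simp [mul_comm]
  have hci : ∑ p, (coeffMM d p : ℂ) * bellSum d (finRotate 3) (finRotate 3)⁻¹ p =
      -((d : ℂ) ^ 3 * Q3 d) := by
    have h := sum_coeffMM_theta hd
    simp only [bellSum_finRotate_inv, mul_left_comm _ (d : ℂ), ← Finset.mul_sum, h]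
    ring
  have hconj : ∀ σ' τ', ∑ p, (coeffMM d p : ℂ) *
      bellSum d (Equiv.swap 0 1 * σ' * (Equiv.swap 0 1)⁻¹)
        (Equiv.swap 0 1 * τ' * (Equiv.swap 0 1)⁻¹) p =
      ∑ p, (coeffMM d p : ℂ) * bellSum d σ' τ' p :=
    fun σ' τ' => sum_coeffMM_mul_bellSum_conj σ' τ' _
  -- Conjugation by a transposition exchanges the two 3-cycles, reducing the four nonzero cases to
  -- two.
  have e1 : (Equiv.swap 0 1 * finRotate 3 * (Equiv.swap 0 1)⁻¹ : Equiv.Perm (Fin 3)) =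
      (finRotate 3)⁻¹ := by decide
  have e2 : (Equiv.swap 0 1 * (finRotate 3)⁻¹ * (Equiv.swap 0 1)⁻¹ : Equiv.Perm (Fin 3)) =
      finRotate 3 := by decide
  have hne : ((finRotate 3)⁻¹ : Equiv.Perm (Fin 3)) ≠ finRotate 3 := by decide
  rcases perm_pair_cases σ τ with ⟨h, h'⟩ | ⟨rfl, rfl⟩ | ⟨rfl, rfl⟩ | ⟨rfl, rfl⟩ | ⟨rfl, rfl⟩
  · have hr : (if σ = finRotate 3 then (d : ℂ) - d ^ 3 else if σ = (finRotate 3)⁻¹ then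
        (d : ℂ) ^ 3 - d else 0) * (if τ = finRotate 3 then (d : ℂ) - d ^ 3 else
        if τ = (finRotate 3)⁻¹ then (d : ℂ) ^ 3 - d else 0) = 0 := by
      rcases h' with ⟨h1, h2⟩ | ⟨h1, h2⟩ <;> simp only [if_neg h1, if_neg h2, zero_mul, mul_zero]
    rw [hr]
    refine mul_eq_zero_of_right _ ?_
    rcases h with (rfl | rfl) | ⟨π, q, hq, rfl, rfl⟩
    · simp only [bellSum_one_left τ]
      exact sum_coeffMM_mul_const hd _
    · simp only [bellSum_one_right σ]
      exact sum_coeffMM_mul_const hd _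
    · rw [sum_coeffMM_mul_bellSum_conj]
      simp only [Finset.mem_insert, Finset.mem_singleton] at hq
      rcases hq with rfl | rfl | rfl | rfl
      · simp only [bellSum_swap_self]
        exact sum_coeffMM_mul_ite hd _
      · simp only [bellSum_swap_swap]
        exact sum_coeffMM_mul_const hd _
      · simp only [bellSum_swap_finRotate]
        exact sum_coeffMM_mul_ite hd _
      · simp only [bellSum_finRotate_swap]
        exact sum_coeffMM_mul_ite hd _
  · rw [hcc, hQ, if_pos rfl]
    field_simp
    ring
  · rw [hci, hQ, if_pos rfl, if_neg hne, if_pos rfl]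
    field_simp
    ring
  · rw [← hconj, e1, e2, hci, hQ, if_pos rfl, if_neg hne, if_pos rfl]
    field_simp
    ring
  · rw [← hconj, e2, hcc, hQ, if_neg hne, if_pos rfl]
    field_simp

theorem Mminus_mem_permSpan : Mminus d ∈ permSpan d :=
  Submodule.sub_mem _ (permOp_mem_permSpan _) (permOp_mem_permSpan _)

theorem Mplus_mem_permSpan : Mplus d ∈ permSpan d :=
  Submodule.add_mem _ (permOp_mem_permSpan _) (permOp_mem_permSpan _)

theorem Mneg_eq (d : ℕ) [NeZero d] :
    Mneg d = (1 / 2 : ℂ) • (Mplus d ⊗ₖ Mplus d - Mminus d ⊗ₖ Mminus d) := by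
  ext x y
  simp only [Mneg, Mplus, Mminus, Matrix.add_apply, Matrix.sub_apply, Matrix.smul_apply,
    Matrix.kroneckerMap_apply, smul_eq_mul]
  ring

variable {μA μB : Measure (UGroup d)} [IsProbabilityMeasure μA] [IsProbabilityMeasure μB]

theorem localTwirl_OMM (hd : 2 ≤ d) (hA : IsUnitaryDesign 3 μA) (hB : IsUnitaryDesign 3 μB) :
    localTwirl μA μB (OMM d) = Mminus d ⊗ₖ Mminus d :=
  localTwirl_eq_of_trace hd hA hB
    (kronecker_mem_permPairSpan Mminus_mem_permSpan Mminus_mem_permSpan)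
    (trace_permOp_mul_OMM_eq hd)

theorem localTwirl_Oplus (hd : 2 ≤ d) (hA : IsUnitaryDesign 3 μA) (hB : IsUnitaryDesign 3 μB) :
    localTwirl μA μB (Oplus d ⊗ₖ Oplus d) = Mplus d ⊗ₖ Mplus d := by
  refine localTwirl_eq_of_trace hd hA hB
    (kronecker_mem_permPairSpan Mplus_mem_permSpan Mplus_mem_permSpan) fun σ τ => ?_
  rw [← Matrix.mul_kronecker_mul, ← Matrix.mul_kronecker_mul, Matrix.trace_kronecker,
    Matrix.trace_kronecker, trace_permOp_mul_Oplus, trace_permOp_mul_Oplus]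

/-- The local twirl of a pair of designs is self-adjoint for the trace pairing. -/
theorem integral_trace_mul_localTwirl (hd : 2 ≤ d) (hA : IsUnitaryDesign 3 μA)
    (hB : IsUnitaryDesign 3 μB) (O R : Matrix (Idx d) (Idx d) ℂ) :
    ∫ g : UGroup d × UGroup d, (O * ((tensorPow 3 (g.1 : Matrix (ZMod d) (ZMod d) ℂ) ⊗ₖ
        tensorPow 3 (g.2 : Matrix (ZMod d) (ZMod d) ℂ)) * R *
      (tensorPow 3 (g.1 : Matrix (ZMod d) (ZMod d) ℂ) ⊗ₖ
        tensorPow 3 (g.2 : Matrix (ZMod d) (ZMod d) ℂ)).conjTranspose)).trace ∂(μA.prod μB) =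
      (localTwirl μA μB O * R).trace := by
  have h := linearMap_localTwirl μA μB R (Matrix.traceLinearMap _ ℂ ℂ ∘ₗ LinearMap.mulLeft ℂ O)
  simp only [LinearMap.comp_apply, Matrix.traceLinearMap_apply, LinearMap.mulLeft_apply] at h
  -- Both twirled operators lie in the commutant, so each pairing equals that of the two twirls. The
  -- ensembles need not be closed under inverses.
  rw [← h, Matrix.trace_mul_comm, ← trace_mul_localTwirl (μA := μA) (μB := μB)
    (localTwirl_mem_permPairSpan hd hA hB R), Matrix.trace_mul_comm,
    trace_mul_localTwirl (localTwirl_mem_permPairSpan hd hA hB O)]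

end Main

end BellNegativity

open BellNegativity in
theorem mainTheorem1 (d : ℕ) [NeZero d] (hd : 2 ≤ d)
    (μA μB : Measure (UGroup d)) [IsProbabilityMeasure μA] [IsProbabilityMeasure μB]
    (hA : IsUnitaryDesign 3 μA) (hB : IsUnitaryDesign 3 μB) :
    (OMM d).IsHermitian ∧
    localTwirl μA μB (OMM d) = Mminus d ⊗ₖ Mminus d ∧
    (∀ ρ : Matrix (ZMod d × ZMod d) (ZMod d × ZMod d) ℂ, ρ.PosSemidef → ρ.trace = 1 →
      ∫ g : UGroup d × UGroup d,
          ∑ p : Fin 3 → ZMod d × ZMod d, (coeffMM d p : ℂ) * ∏ i, bellProb ρ g.1 g.2 (p i)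
            ∂(μA.prod μB) =
        ((Mminus d ⊗ₖ Mminus d) * copyTensor fun _ => ρ).trace) ∧
    localTwirl μA μB (Oplus d ⊗ₖ Oplus d) = Mplus d ⊗ₖ Mplus d ∧
    Mneg d = (1 / 2 : ℂ) • (Mplus d ⊗ₖ Mplus d - Mminus d ⊗ₖ Mminus d) ∧
    localTwirl μA μB ((1 / 2 : ℂ) • (Oplus d ⊗ₖ Oplus d - OMM d)) = Mneg d := by
  have hM := localTwirl_OMM hd hA hB
  have hP := localTwirl_Oplus hd hA hB
  refine ⟨isHermitian_OMM, hM, fun ρ _ _ => ?_, hP, Mneg_eq d, ?_⟩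
  · simp only [sum_mul_prod_bellProb]
    rw [← hM]
    exact integral_trace_mul_localTwirl hd hA hB (OMM d) _
  · rw [Mneg_eq, ← hP, ← hM]
    change localTwirlLinear μA μB _ = (1 / 2 : ℂ) • (localTwirlLinear μA μB _ -
      localTwirlLinear μA μB _)
    rw [map_smul, map_sub]
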